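/- Let $p\in\{1,2\}$. For $x\in\mathbb R^n$ write $\|x_{\overline{[k]}}\|_p=\min_{|S|\le k}\|x_{[n]\setminus S}\|_p$ for the $\ell_p$ norm of $x$ outside its $k$ largest coordinates in absolute value. A one-round algorithm with $m$ measurements consists of a random matrix $A\in\mathbb R^{m\times n}$ and a (randomized) recovery procedure that computes $\hat x$ from $Ax$. A two-round algorithm with $m_1$ measurements in the first round and $m_2$ in the second consists of a random matrix $A_1\in\mathbb R^{m_1\times n}$, a random matrix $A_2\in\mathbb R^{m_2\times n}$ that may depend on $A_1x$, and a recovery procedure that computes $\hat x$ from $A_1x$ and $A_2x$ (all with shared randomness). Such an algorithm performs $k$-sparse recovery with factor $1+\varepsilon$ and failure probability $\delta$ if for every fixed $x\in\mathbb R^n$, with probability at least $1-\delta$, $$\|\hat x-x\|_p\le(1+\varepsilon)\,\|x_{\overline{[k]}}\|_p .$$ For every constant $C_0\in\mathbb N$ there are constants $C_1,a,C_2\in\mathbb N$ with $C_1\ge1$ and $c\in(0,1)$, depending only on $p$ and $C_0$, such that the following holds. Let $m(k,\varepsilon,n,\delta)$ and $s(k,\varepsilon,n,\delta)$ be $\mathbb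 N$-valued functions such that for all integers $1\le k\le n$ and reals $\varepsilon>0$, $0<\delta<1$ there is a one-round algorithm for vectors in $\mathbb R^n$ that uses $m(k,\varepsilon,n,\delta)$ measurements, performs $k$-sparse recovery with factor $1+\varepsilon$ and failure probability $\delta$, and whose output always has at most $s(k,\varepsilon,n,\delta)$ non-zero coordinates, where $s(k,\varepsilon,n,\delta)\le C_0k$. Then for all integers $k,n\ge1$ and every $\varepsilon>0$, with $N=C_1\lceil k/\min\{\varepsilon,1\}\rceil^{a}$ (so $N=\mathrm{poly}(k/\varepsilon)$ for $\varepsilon\le1$), there is a two-round algorithm for vectors in $\mathbb R^n$ that performs $k$-sparse recovery with factor $1+\varepsilon$ and succeeds with probability at least $2/3$, uses $m(k,\varepsilon/5,N,1/100)$ measurements in the first round, and uses at most $C_2\,k\cdot m(1,1,n,c/k)$ measurements in the second round. -/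

import Mathlib

open MeasureTheory
open scoped ENNReal Matrix

noncomputable section

namespace SparseRecovery

/-- The `ℓ_p` norm of a real vector. -/
def pNorm (p : ℝ≥0∞) {n : ℕ} (x : Fin n → ℝ) : ℝ := ‖WithLp.toLp p x‖

/-- The support of a vector, as a finite set of coordinates. -/
def supp {n : ℕ} (x : Fin n → ℝ) : Finset (Fin n) := {i | x i ≠ 0}

/-- The `ℓ_p` norm of `x` outside its `k` largest coordinates: the least value of
`‖x_{[n] \ S}‖_p` over all sets `S` of at most `k` coordinates. -/
def tailNorm (p : ℝ≥0∞) (k : ℕ) {n : ℕ} (x : Fin n → ℝ) : ℝ :=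
  ⨅ S : {S : Finset (Fin n) // S.card ≤ k}, pNorm p (fun i => if i ∈ S.1 then 0 else x i)

/-- A randomized one-round (non-adaptive) algorithm for `n`-dimensional vectors that takes `m`
linear measurements: a random `m × n` matrix `A` and a recovery procedure that is given the
measurement vector `A x` and has access to the randomness `ω`. -/
structure OneRoundAlg (n m : ℕ) where
  Ω : Type
  [mΩ : MeasurableSpace Ω]
  μ : Measure Ω
  [prob : IsProbabilityMeasure μ]
  A : Ω → Matrix (Fin m) (Fin n) ℝ
  measurable_A : ∀ i j, Measurable (fun ω => A ω i j)
  recover : Ω → (Fin m → ℝ) → (Fin n → ℝ)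
  measurable_recover : Measurable (fun q : Ω × (Fin m → ℝ) => recover q.1 q.2)

attribute [instance] OneRoundAlg.mΩ OneRoundAlg.prob

/-- The output of the algorithm on the input vector `x`. -/
def OneRoundAlg.output {n m : ℕ} (R : OneRoundAlg n m) (x : Fin n → ℝ) (ω : R.Ω) :
    Fin n → ℝ :=
  R.recover ω (R.A ω *ᵥ x)

/-- `k`-sparse recovery with the `ℓ_p/ℓ_p` guarantee, approximation factor `1 + ε` and failure
probability at most `δ`, for every fixed input vector. -/
def OneRoundAlg.Succeeds {n m : ℕ} (R : OneRoundAlg n m) (p : ℝ≥0∞) (k : ℕ) (ε δ : ℝ) : Prop :=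
  ∀ x : Fin n → ℝ,
    1 - δ ≤ R.μ.real {ω | pNorm p (R.output x ω - x) ≤ (1 + ε) * tailNorm p k x}

/-- Every output of the algorithm has at most `s` non-zero coordinates. -/
def OneRoundAlg.SupportBound {n m : ℕ} (R : OneRoundAlg n m) (s : ℕ) : Prop :=
  ∀ ω b, (supp (R.recover ω b)).card ≤ s

/-- A randomized two-round algorithm for `n`-dimensional vectors that takes `m₁` linear
measurements in the first round and `m₂` in the second: the matrix `A₂` of the second round may
depend on the randomness and on the outcome of the measurements of the first round. -/
structure TwoRoundAlg (n m₁ m₂ : ℕ) where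
  Ω : Type
  [mΩ : MeasurableSpace Ω]
  μ : Measure Ω
  [prob : IsProbabilityMeasure μ]
  A₁ : Ω → Matrix (Fin m₁) (Fin n) ℝ
  measurable_A₁ : ∀ i j, Measurable (fun ω => A₁ ω i j)
  A₂ : Ω → (Fin m₁ → ℝ) → Matrix (Fin m₂) (Fin n) ℝ
  measurable_A₂ : ∀ i j, Measurable (fun q : Ω × (Fin m₁ → ℝ) => A₂ q.1 q.2 i j)
  recover : Ω → (Fin m₁ → ℝ) → (Fin m₂ → ℝ) → (Fin n → ℝ)
  measurable_recover :
    Measurable (fun q : Ω × (Fin m₁ → ℝ) × (Fin m₂ → ℝ) => recover q.1 q.2.1 q.2.2)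

attribute [instance] TwoRoundAlg.mΩ TwoRoundAlg.prob

/-- The output of the two-round algorithm on the input vector `x`. -/
def TwoRoundAlg.output {n m₁ m₂ : ℕ} (R : TwoRoundAlg n m₁ m₂) (x : Fin n → ℝ) (ω : R.Ω) :
    Fin n → ℝ :=
  R.recover ω (R.A₁ ω *ᵥ x) (R.A₂ ω (R.A₁ ω *ᵥ x) *ᵥ x)

/-- `k`-sparse recovery with the `ℓ_p/ℓ_p` guarantee, approximation factor `1 + ε` and failure
probability at most `δ`, for every fixed input vector. -/
def TwoRoundAlg.Succeeds {n m₁ m₂ : ℕ} (R : TwoRoundAlg n m₁ m₂) (p : ℝ≥0∞) (k : ℕ)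
    (ε δ : ℝ) : Prop :=
  ∀ x : Fin n → ℝ,
    1 - δ ≤ R.μ.real {ω | pNorm p (R.output x ω - x) ≤ (1 + ε) * tailNorm p k x}

/-- There is a one-round `k`-sparse recovery algorithm for `n`-dimensional vectors, with
approximation factor `1 + ε` and failure probability `δ`, that uses `m k ε n δ` measurements and
whose output has at most `s k ε n δ` non-zero coordinates, for all admissible parameters. -/
def HasOneRoundAlgs (p : ℝ≥0∞) (m s : ℕ → ℝ → ℕ → ℝ → ℕ) : Prop :=
  ∀ (k : ℕ) (ε : ℝ) (n : ℕ) (δ : ℝ), 1 ≤ k → k ≤ n → 0 < ε → 0 < δ → δ < 1 →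
    ∃ R : OneRoundAlg n (m k ε n δ), R.Succeeds p k ε δ ∧ R.SupportBound (s k ε n δ)

end SparseRecovery

end

noncomputable section

namespace SparseRecovery

/-! Hash the `n` coordinates with random signs into `N = poly(k/ε)` buckets and run the one-round
algorithm on the sketch `y`. This costs no extra measurements, since a matrix times the sketch
matrix is again linear in `x`. The support `T` of its output is a set of at most `K = C₀ k` buckets.
The second round runs a 1-sparse recovery with factor 2 inside each bucket of `T`, and every other
coordinate is output as 0.

Let `H` be an optimal set of `k` coordinates and `t` the `q`-th power of the tail norm, where `q =
p`. Let `L` be `H` together with all coordinates of mass above `τ t`; it has at most `k + 1/τ`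
elements. With constant probability (`card_not_good_le`) the hash is injective on `L`, each bucket
receives mass and signed noise at most `g² t` from outside `L`, and `y` has mass at most `4t`
outside the image of `H`.

The bound `4t` is too weak to compare all of `y` with `x`. Near-optimality of `T` is therefore used
as an exchange: buckets that lie neither in `T` nor in the image of `H` cancel, so the mass of `y`
lost on the image of `H` is at most the mass gained on `T` plus `O(ε) t`. Only `O(k)` buckets
remain, and each can be converted from `y` to `x` at cost `O((1 + ε) g) t` (`sum_uncaptured_le`). In
the second round a bucket contains at most one element of `L`, so its 1-sparse tail is at most `g²
t` (`tailNorm_slotPart_pow_le`). Taking `g` a small multiple of `min(ε, 1)/k` makes the total at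
most `(1 + ε)^q t` (`sketchAndRefine_succeeds`). -/

/-- The natural number `q` is the exponent of the `ℓ_p` norm, where `p ∈ {1, 2}`. -/
def IsExponent (p : ℝ≥0∞) (q : ℕ) : Prop := (p = 1 ∧ q = 1) ∨ (p = 2 ∧ q = 2)

lemma IsExponent.ne_zero {p : ℝ≥0∞} {q : ℕ} (hpq : IsExponent p q) : q ≠ 0 := by
  rcases hpq with ⟨-, rfl⟩ | ⟨-, rfl⟩ <;> norm_num

/-! ### Norms and tails through their `q`-th powers -/

lemma pNorm_nonneg {p : ℝ≥0∞} {q : ℕ} (hpq : IsExponent p q) {n : ℕ} (x : Fin n → ℝ) :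
    0 ≤ pNorm p x := by
  rcases hpq with ⟨rfl, -⟩ | ⟨rfl, -⟩ <;> exact norm_nonneg _

lemma pNorm_pow {p : ℝ≥0∞} {q : ℕ} (hpq : IsExponent p q) {n : ℕ} (x : Fin n → ℝ) :
    pNorm p x ^ q = ∑ i, |x i| ^ q := by
  rcases hpq with ⟨rfl, rfl⟩ | ⟨rfl, rfl⟩
  · simp [pNorm, PiLp.norm_eq_of_L1]
  · simp [pNorm, EuclideanSpace.norm_sq_eq]

lemma measurable_pNorm {p : ℝ≥0∞} {q : ℕ} (hpq : IsExponent p q) {n : ℕ} :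
    Measurable (pNorm p : (Fin n → ℝ) → ℝ) := by
  rcases hpq with ⟨rfl, rfl⟩ | ⟨rfl, rfl⟩
  · have : (pNorm 1 : (Fin n → ℝ) → ℝ) = fun x => ∑ i, |x i| := by
      funext x; simp [pNorm, PiLp.norm_eq_of_L1]
    rw [this]; fun_prop
  · have : (pNorm 2 : (Fin n → ℝ) → ℝ) = fun x => √(∑ i, |x i| ^ 2) := by
      funext x; simp [pNorm, EuclideanSpace.norm_eq]
    rw [this]; fun_prop

lemma exists_tailNorm_eq (p : ℝ≥0∞) (k : ℕ) {n : ℕ} (x : Fin n → ℝ) :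
    ∃ S : Finset (Fin n), S.card ≤ k ∧
      tailNorm p k x = pNorm p (fun i => if i ∈ S then 0 else x i) := by
  have : Nonempty {S : Finset (Fin n) // S.card ≤ k} := ⟨⟨∅, by simp⟩⟩
  obtain ⟨S, hS⟩ := exists_eq_ciInf_of_finite
    (f := fun S : {S : Finset (Fin n) // S.card ≤ k} =>
      pNorm p (fun i => if i ∈ S.1 then 0 else x i))
  exact ⟨S.1, S.2, hS.symm⟩

lemma tailNorm_le (p : ℝ≥0∞) {k : ℕ} {n : ℕ} (x : Fin n → ℝ) {S : Finset (Fin n)}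
    (hS : S.card ≤ k) : tailNorm p k x ≤ pNorm p (fun i => if i ∈ S then 0 else x i) :=
  ciInf_le (f := fun S : {S : Finset (Fin n) // S.card ≤ k} =>
    pNorm p (fun i => if i ∈ S.1 then 0 else x i)) (Set.finite_range _).bddBelow ⟨S, hS⟩

lemma tailNorm_nonneg {p : ℝ≥0∞} {q : ℕ} (hpq : IsExponent p q) (k : ℕ) {n : ℕ}
    (x : Fin n → ℝ) : 0 ≤ tailNorm p k x := by
  obtain ⟨S, -, hS⟩ := exists_tailNorm_eq p k x
  exact hS ▸ pNorm_nonneg hpq _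

lemma pNorm_mask_pow {p : ℝ≥0∞} {q : ℕ} (hpq : IsExponent p q) {n : ℕ} (x : Fin n → ℝ)
    (S : Finset (Fin n)) :
    pNorm p (fun i => if i ∈ S then 0 else x i) ^ q = ∑ i ∈ Sᶜ, |x i| ^ q := by
  rw [pNorm_pow hpq, ← Finset.sum_compl_add_sum S]
  have h1 : ∑ i ∈ S, |if i ∈ S then 0 else x i| ^ q = 0 :=
    Finset.sum_eq_zero fun i hi => by simp [hi, hpq.ne_zero]
  rw [h1, add_zero]
  exact Finset.sum_congr rfl fun i hi => by simp [Finset.mem_compl.mp hi]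

lemma tailNorm_pow_le {p : ℝ≥0∞} {q : ℕ} (hpq : IsExponent p q) {k : ℕ} {n : ℕ}
    (x : Fin n → ℝ) {S : Finset (Fin n)} (hS : S.card ≤ k) :
    tailNorm p k x ^ q ≤ ∑ i ∈ Sᶜ, |x i| ^ q := by
  rw [← pNorm_mask_pow hpq]
  exact pow_le_pow_left₀ (tailNorm_nonneg hpq k x) (tailNorm_le p x hS) q

lemma exists_tailNorm_pow_eq {p : ℝ≥0∞} {q : ℕ} (hpq : IsExponent p q) (k : ℕ) {n : ℕ}
    (x : Fin n → ℝ) :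
    ∃ S : Finset (Fin n), S.card ≤ k ∧ tailNorm p k x ^ q = ∑ i ∈ Sᶜ, |x i| ^ q := by
  obtain ⟨S, hS, h⟩ := exists_tailNorm_eq p k x
  exact ⟨S, hS, by rw [h, pNorm_mask_pow hpq]⟩

/-- The restriction of a vector to the coordinates in the slot `l` of a partial partition `g`
of the coordinates. -/
def slotPart {n K : ℕ} (g : Fin n → Option (Fin K)) (l : Fin K) (x : Fin n → ℝ) : Fin n → ℝ :=
  fun i => if g i = some l then x i else 0

lemma OneRoundAlg.measurable_output {n m : ℕ} (R : OneRoundAlg n m) (x : Fin n → ℝ) :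
    Measurable (R.output x) := by
  refine R.measurable_recover.comp (measurable_id.prodMk (measurable_pi_iff.2 fun j => ?_))
  change Measurable fun ω => ∑ i, R.A ω j i * x i
  exact Finset.measurable_sum _ fun i _ => (R.measurable_A j i).mul_const _

lemma OneRoundAlg.measurableSet_close {n m : ℕ} (R : OneRoundAlg n m) {p : ℝ≥0∞} {q : ℕ}
    (hpq : IsExponent p q) (x : Fin n → ℝ) (r : ℝ) :
    MeasurableSet {ω | pNorm p (R.output x ω - x) ≤ r} :=
  measurableSet_le ((measurable_pNorm hpq).comp ((R.measurable_output x).sub_const x))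
    measurable_const

lemma OneRoundAlg.Succeeds.measure_far_le {n m : ℕ} {R : OneRoundAlg n m} {p : ℝ≥0∞} {q k : ℕ}
    {ε δ : ℝ} (hR : R.Succeeds p k ε δ) (hpq : IsExponent p q) (x : Fin n → ℝ) :
    R.μ.real {ω | ¬ pNorm p (R.output x ω - x) ≤ (1 + ε) * tailNorm p k x} ≤ δ := by
  have h := probReal_compl_eq_one_sub (μ := R.μ)
    (R.measurableSet_close hpq x ((1 + ε) * tailNorm p k x))
  have h' := hR x
  rw [Set.compl_ofPred] at h
  linarith

/-- Adaptivity enters only through a value in a finite type (the slot assignment), so measurability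
can be checked separately for each value. -/
lemma measurable_of_finite_fst {α β γ F : Type*} [MeasurableSpace α] [MeasurableSpace β]
    [MeasurableSpace γ] [Finite F] {f : α → F} (hf : ∀ t, MeasurableSet {a | f a = t})
    {Φ : F → α → β → γ} (hΦ : ∀ t, Measurable fun z : α × β => Φ t z.1 z.2) :
    Measurable fun z : α × β => Φ (f z.1) z.1 z.2 := by
  intro s hs
  have : (fun z : α × β => Φ (f z.1) z.1 z.2) ⁻¹' s =
      ⋃ t, (Prod.fst ⁻¹' {a | f a = t}) ∩ ((fun z : α × β => Φ t z.1 z.2) ⁻¹' s) := by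
    ext z; simp
  rw [this]
  exact MeasurableSet.iUnion fun t => (measurable_fst (hf t)).inter (hΦ t hs)

lemma measurableSet_eq_supp {n : ℕ} {α : Type*} [MeasurableSpace α] {f : α → Fin n → ℝ}
    (hf : Measurable f) (T : Finset (Fin n)) : MeasurableSet {a | supp (f a) = T} := by
  have : {a | supp (f a) = T} = ⋂ i, {a | f a i ≠ 0 ↔ i ∈ T} := by
    ext a; simp [supp, Finset.ext_iff]
  rw [this]
  refine MeasurableSet.iInter fun i => ?_
  have h0 : MeasurableSet {a | f a i = 0} :=
    (measurable_pi_iff.1 hf i) (measurableSet_singleton 0)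
  by_cases hi : i ∈ T
  · convert h0.compl using 1
    ext a; simp [hi]
  · convert h0 using 1
    ext a; simp [hi]

/-! ### The two-round algorithm -/

section Construction

variable {Θ : Type} [Finite Θ] [MeasurableSpace Θ] [MeasurableSingletonClass Θ]
  {n N m₁ m₂ K : ℕ}

/-- The partial partition of the coordinates into slots which the second round works on. -/
def slotOf {Ω : Type} (g : Θ → Finset (Fin N) → Fin n → Option (Fin K))
    (r : Ω → (Fin m₁ → ℝ) → Fin N → ℝ) (z : (Θ × Ω) × (Fin m₁ → ℝ)) : Fin n → Option (Fin K) :=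
  g z.1.1 (supp (r z.1.2 z.2))

lemma measurableSet_slotOf_eq {Ω : Type} [MeasurableSpace Ω]
    (g : Θ → Finset (Fin N) → Fin n → Option (Fin K)) {r : Ω → (Fin m₁ → ℝ) → Fin N → ℝ}
    (hr : Measurable fun z : Ω × (Fin m₁ → ℝ) => r z.1 z.2) (t : Fin n → Option (Fin K)) :
    MeasurableSet {z | slotOf g r z = t} := by
  have : {z | slotOf g r z = t} = ⋃ θ : Θ, ⋃ T : Finset (Fin N), ⋃ _ : g θ T = t,
      {z : (Θ × Ω) × (Fin m₁ → ℝ) | z.1.1 = θ} ∩ {z | supp (r z.1.2 z.2) = T} := by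
    ext z; simp [slotOf]
  rw [this]
  have hr' : Measurable fun z : (Θ × Ω) × (Fin m₁ → ℝ) => r z.1.2 z.2 :=
    hr.comp ((measurable_snd.comp measurable_fst).prodMk measurable_snd)
  exact MeasurableSet.iUnion fun θ => MeasurableSet.iUnion fun T => MeasurableSet.iUnion fun _ =>
    ((measurable_fst.comp measurable_fst) (measurableSet_singleton θ)).inter
      (measurableSet_eq_supp hr' T)

/-- The two-round algorithm that sketches the input by the random matrix `S` and applies `R₁` to
the sketch; the support of the outcome determines disjoint slots of coordinates, and
`R₂` is applied to each of them in the second round. -/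
def sketchAndRefine (ν : Measure Θ) [IsProbabilityMeasure ν] (S : Θ → Matrix (Fin N) (Fin n) ℝ)
    (g : Θ → Finset (Fin N) → Fin n → Option (Fin K)) (R₁ : OneRoundAlg N m₁)
    (R₂ : OneRoundAlg n m₂) : TwoRoundAlg n m₁ (K * m₂) where
  Ω := (Θ × R₁.Ω) × R₂.Ω
  μ := (ν.prod R₁.μ).prod R₂.μ
  A₁ ω := R₁.A ω.1.2 * S ω.1.1
  measurable_A₁ i j := by
    simp only [Matrix.mul_apply]
    refine Finset.measurable_sum _ fun l _ => Measurable.mul ?_ ?_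
    · exact (R₁.measurable_A i l).comp (measurable_snd.comp measurable_fst)
    · exact (measurable_of_finite fun θ => S θ l j).comp (measurable_fst.comp measurable_fst)
  -- A row index encodes a pair (slot, row of `R₂.A`). All slots share one sample of `R₂`; the later
  -- union bound needs no independence between slots.
  A₂ ω b := Matrix.of fun l i =>
    if slotOf g R₁.recover (ω.1, b) i = some (finProdFinEquiv.symm l).1 then
      R₂.A ω.2 (finProdFinEquiv.symm l).2 i else 0
  measurable_A₂ l i := by
    have h := measurable_of_finite_fst (β := R₂.Ω)
      (measurableSet_slotOf_eq (Θ := Θ) g R₁.measurable_recover)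
      (Φ := fun t _ ω => if t i = some (finProdFinEquiv.symm l).1 then
        R₂.A ω (finProdFinEquiv.symm l).2 i else 0) fun t => by
          by_cases ht : t i = some (finProdFinEquiv.symm l).1
          · simp only [if_pos ht]
            exact (R₂.measurable_A _ i).comp measurable_snd
          · simp only [if_neg ht]
            exact measurable_const
    exact h.comp (((measurable_fst.comp measurable_fst).prodMk measurable_snd).prodMk
      (measurable_snd.comp measurable_fst))
  recover ω b b' := fun i => (slotOf g R₁.recover (ω.1, b) i).elim 0
    fun l => R₂.recover ω.2 (fun r => b' (finProdFinEquiv (l, r))) i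
  measurable_recover := by
    have h := measurable_of_finite_fst (β := R₂.Ω × (Fin (K * m₂) → ℝ))
      (measurableSet_slotOf_eq (Θ := Θ) g R₁.measurable_recover)
      (Φ := fun t _ z (i : Fin n) => (t i).elim 0
        fun l => R₂.recover z.1 (fun r => z.2 (finProdFinEquiv (l, r))) i) fun t => by
          refine measurable_pi_iff.2 fun i => ?_
          rcases ht : t i with _ | l
          · simp
          · refine ((measurable_pi_apply i).comp R₂.measurable_recover).comp
              (((measurable_fst.comp measurable_snd)).prodMk (measurable_pi_iff.2 fun r => ?_))
            exact (measurable_pi_apply _).comp (measurable_snd.comp measurable_snd)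
    exact h.comp (((measurable_fst.comp measurable_fst).prodMk
      (measurable_fst.comp measurable_snd)).prodMk
        ((measurable_snd.comp measurable_fst).prodMk (measurable_snd.comp measurable_snd)))

variable (ν : Measure Θ) [IsProbabilityMeasure ν] (S : Θ → Matrix (Fin N) (Fin n) ℝ)
  (g : Θ → Finset (Fin N) → Fin n → Option (Fin K)) (R₁ : OneRoundAlg N m₁)
  (R₂ : OneRoundAlg n m₂)

lemma sketchAndRefine_output (x : Fin n → ℝ) (θ : Θ) (ω₁ : R₁.Ω) (ω₂ : R₂.Ω) (i : Fin n) :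
    (sketchAndRefine ν S g R₁ R₂).output x ((θ, ω₁), ω₂) i =
      (g θ (supp (R₁.output (S θ *ᵥ x) ω₁)) i).elim 0
        fun l => R₂.output (slotPart (g θ (supp (R₁.output (S θ *ᵥ x) ω₁))) l x) ω₂ i := by
  simp only [TwoRoundAlg.output, sketchAndRefine, slotOf, OneRoundAlg.output,
    Matrix.mulVec_mulVec]
  congr 1
  funext l
  congr 2
  funext r
  simp only [Matrix.mulVec_apply, Matrix.row, Matrix.of_apply, Equiv.symm_apply_apply, slotPart, dotProduct,
    ite_mul, mul_ite, zero_mul, mul_zero]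

/-- The error of `sketchAndRefine` splits into the coordinates outside the slots, and the errors
of the refinements on the slots. -/
lemma sketchAndRefine_error_le {p : ℝ≥0∞} {q : ℕ} (hpq : IsExponent p q) (x : Fin n → ℝ) (θ : Θ)
    (ω₁ : R₁.Ω) (ω₂ : R₂.Ω) (f : Fin n → Option (Fin K))
    (hf : g θ (supp (R₁.output (S θ *ᵥ x) ω₁)) = f) :
    pNorm p ((sketchAndRefine ν S g R₁ R₂).output x ((θ, ω₁), ω₂) - x) ^ q ≤
      (∑ i with f i = none, |x i| ^ q) +
        ∑ l, pNorm p (R₂.output (slotPart f l x) ω₂ - slotPart f l x) ^ q := by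
  simp only [pNorm_pow hpq, Pi.sub_apply]
  rw [Finset.sum_comm, Finset.sum_filter, ← Finset.sum_add_distrib]
  refine Finset.sum_le_sum fun i _ => ?_
  rw [sketchAndRefine_output, hf]
  have hnn : ∀ l, 0 ≤ |R₂.output (slotPart f l x) ω₂ i - slotPart f l x i| ^ q :=
    fun l => by positivity
  rcases hi : f i with _ | l
  · simpa using Finset.sum_nonneg fun l _ => hnn l
  · have h := Finset.single_le_sum (fun l _ => hnn l) (Finset.mem_univ l)
    have hx : slotPart f l x i = x i := by simp [slotPart, hi]
    rw [hx] at h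
    simpa using h

end Construction

/-! ### Hash sketches and their deterministic analysis -/

/-- The sketch that hashes the coordinates into buckets by `h` and adds them up with the
signs `σ`. -/
def hashMatrix {n N : ℕ} (h : Fin n → Fin N) (σ : Fin n → ℝ) : Matrix (Fin N) (Fin n) ℝ :=
  Matrix.of fun j i => if h i = j then σ i else 0

lemma hashMatrix_mulVec {n N : ℕ} (h : Fin n → Fin N) (σ x : Fin n → ℝ) (j : Fin N) :
    (hashMatrix h σ *ᵥ x) j = ∑ i with h i = j, σ i * x i := by
  simp [hashMatrix, Matrix.mulVec, dotProduct, Finset.sum_filter]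

/-- For `q = 2` the cross term `2be` is at most `2A g t` by multiplying the two square bounds. This
is why noise is measured as `g² t` while errors are counted in units of `g t`. -/
lemma pow_le_add_of_le_add {p : ℝ≥0∞} {q : ℕ} (hpq : IsExponent p q) {a b e t g A : ℝ}
    (ha : 0 ≤ a) (ht : 0 ≤ t) (hg : 0 ≤ g) (hg1 : g ≤ 1)
    (hA : 0 ≤ A) (hab : a ≤ b + e) (hbt : b ^ q ≤ A ^ 2 * t) (het : e ^ q ≤ g ^ 2 * t) :
    a ^ q ≤ b ^ q + (2 * A + 1) * g * t := by
  have hgt : 0 ≤ g * t := mul_nonneg hg ht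
  have hg2 : g ^ 2 * t ≤ g * t := by nlinarith
  have hAgt : 0 ≤ A * (g * t) := mul_nonneg hA hgt
  rcases hpq with ⟨-, rfl⟩ | ⟨-, rfl⟩
  · simp only [pow_one] at *
    linarith
  · have hbe : b * e ≤ A * (g * t) := by
      refine abs_le_of_sq_le_sq' ?_ hAgt |>.2
      calc (b * e) ^ 2 = b ^ 2 * e ^ 2 := by ring
        _ ≤ (A ^ 2 * t) * (g ^ 2 * t) := by gcongr
        _ = _ := by ring
    have : a ^ 2 ≤ (b + e) ^ 2 := by gcongr
    nlinarith

section Deterministic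

variable {n N : ℕ} {h : Fin n → Fin N} {σ : Fin n → ℝ} {L : Finset (Fin n)}

/-- The contribution to the bucket `j` of the coordinates outside `L`. -/
def bucketNoise (h : Fin n → Fin N) (σ : Fin n → ℝ) (L : Finset (Fin n)) (x : Fin n → ℝ)
    (j : Fin N) : ℝ :=
  ∑ i ∈ Lᶜ with h i = j, σ i * x i

lemma hashMatrix_mulVec_of_mem (hL : Set.InjOn h L) (x : Fin n → ℝ) {i : Fin n} (hi : i ∈ L) :
    (hashMatrix h σ *ᵥ x) (h i) = σ i * x i + bucketNoise h σ L x (h i) := by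
  rw [hashMatrix_mulVec, bucketNoise, Finset.sum_filter, Finset.sum_filter,
    ← Finset.sum_add_sum_compl L]
  congr 1
  rw [Finset.sum_eq_single_of_mem i hi, if_pos rfl]
  intro i' hi' hne
  exact if_neg fun he => hne (hL hi' hi he)

lemma hashMatrix_mulVec_of_forall_ne (x : Fin n → ℝ) {j : Fin N} (hj : ∀ i ∈ L, h i ≠ j) :
    (hashMatrix h σ *ᵥ x) j = bucketNoise h σ L x j := by
  rw [hashMatrix_mulVec, bucketNoise, Finset.sum_filter, Finset.sum_filter,
    ← Finset.sum_add_sum_compl L, Finset.sum_eq_zero fun i hi => if_neg (hj i hi), zero_add]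

/-- If the heavy coordinates are isolated and the noise of every bucket is small, a set `T` of
buckets which captures the sketch almost optimally captures the vector almost optimally. -/
lemma sum_uncaptured_le {p : ℝ≥0∞} {q : ℕ} (hpq : IsExponent p q) (x : Fin n → ℝ)
    {H : Finset (Fin n)} {T : Finset (Fin N)} {k K : ℕ} {ε g : ℝ} (hHL : H ⊆ L)
    (hL : Set.InjOn h L) (hσ : ∀ i, |σ i| = 1) (hH : H.card ≤ k) (hT : T.card ≤ K) (hε : 0 ≤ ε)
    (hg : 0 ≤ g) (hg1 : g ≤ 1)
    (hnoise : ∀ j, |bucketNoise h σ L x j| ^ q ≤ g ^ 2 * ∑ i ∈ Hᶜ, |x i| ^ q)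
    (hmass : ∑ j ∈ (H.image h)ᶜ, |(hashMatrix h σ *ᵥ x) j| ^ q ≤ 4 * ∑ i ∈ Hᶜ, |x i| ^ q)
    (happrox : ∑ j ∈ Tᶜ, |(hashMatrix h σ *ᵥ x) j| ^ q ≤
      (1 + ε / 5) ^ q * ∑ j ∈ (H.image h)ᶜ, |(hashMatrix h σ *ᵥ x) j| ^ q) :
    ∑ i with h i ∉ T, |x i| ^ q ≤
      (1 + 4 * ((1 + ε / 5) ^ q - 1) + 3 * K * g + k * (5 + ε) * g) * ∑ i ∈ Hᶜ, |x i| ^ q := by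
  set y := hashMatrix h σ *ᵥ x with hy
  set t := ∑ i ∈ Hᶜ, |x i| ^ q with ht
  have ht0 : 0 ≤ t := Finset.sum_nonneg fun i _ => by positivity
  have hgt : 0 ≤ g * t := mul_nonneg hg ht0
  have hg2 : g ^ 2 * t ≤ g * t := by nlinarith
  have hβ : 1 ≤ (1 + ε / 5) ^ q := one_le_pow₀ (by linarith)
  have hYnn : ∀ j, 0 ≤ |y j| ^ q := fun j => by positivity
  have hXnn : ∀ i, 0 ≤ |x i| ^ q := fun i => by positivity
  -- buckets without an element of `H`
  have hlight : ∀ j ∉ H.image h, |y j| ^ q ≤ ∑ i ∈ Hᶜ with h i = j, |x i| ^ q + 3 * g * t := by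
    intro j hj
    by_cases hex : ∃ i ∈ L, h i = j
    · obtain ⟨i, hi, rfl⟩ := hex
      have hiH : i ∈ Hᶜ := Finset.mem_compl.2 fun hi' => hj (Finset.mem_image_of_mem h hi')
      have h1 : |x i| ^ q ≤ ∑ i' ∈ Hᶜ with h i' = h i, |x i'| ^ q :=
        Finset.single_le_sum (f := fun i => |x i| ^ q) (fun i _ => hXnn i) (by simpa using hiH)
      have h2 : |x i| ^ q ≤ 1 ^ 2 * t := by
        rw [one_pow, one_mul]
        exact Finset.single_le_sum (f := fun i => |x i| ^ q) (fun i _ => hXnn i) hiH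
      have h3 : |y (h i)| ≤ |x i| + |bucketNoise h σ L x (h i)| := by
        rw [hy, hashMatrix_mulVec_of_mem hL x hi]
        refine (abs_add_le _ _).trans_eq ?_
        rw [abs_mul, hσ, one_mul]
      have := pow_le_add_of_le_add hpq (abs_nonneg _) ht0 hg hg1
        zero_le_one h3 h2 (hnoise (h i))
      linarith
    · push Not at hex
      rw [hy, hashMatrix_mulVec_of_forall_ne x hex]
      have : 0 ≤ ∑ i ∈ Hᶜ with h i = j, |x i| ^ q := Finset.sum_nonneg fun i _ => hXnn i
      linarith [hnoise j]
  -- The noise is paid once per bucket of `T`, hence at most `K` times and not `N` times.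
  have hsplitT : ∑ j ∈ T \ H.image h, |y j| ^ q ≤
      ∑ i ∈ Hᶜ with h i ∈ T, |x i| ^ q + K * (3 * g * t) := by
    calc ∑ j ∈ T \ H.image h, |y j| ^ q
        ≤ ∑ j ∈ T \ H.image h, (∑ i ∈ Hᶜ with h i = j, |x i| ^ q + 3 * g * t) :=
          Finset.sum_le_sum fun j hj => hlight j (Finset.mem_sdiff.1 hj).2
      _ ≤ ∑ j ∈ T, (∑ i ∈ Hᶜ with h i = j, |x i| ^ q + 3 * g * t) := by
          refine Finset.sum_le_sum_of_subset_of_nonneg Finset.sdiff_subset fun j _ _ => ?_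
          have : 0 ≤ ∑ i ∈ Hᶜ with h i = j, |x i| ^ q := Finset.sum_nonneg fun i _ => hXnn i
          linarith
      _ = ∑ i ∈ Hᶜ with h i ∈ T, |x i| ^ q + T.card * (3 * g * t) := by
          rw [Finset.sum_add_distrib, Finset.sum_const, nsmul_eq_mul]
          congr 1
          rw [← Finset.sum_fiberwise_of_maps_to (s := Hᶜ.filter fun i => h i ∈ T) (t := T)
            (g := h) fun i hi => (Finset.mem_filter.1 hi).2]
          refine Finset.sum_congr rfl fun j hj => Finset.sum_congr ?_ fun _ _ => rfl
          ext i
          simp only [Finset.mem_filter]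
          constructor
          · rintro ⟨h1, rfl⟩; exact ⟨⟨h1, hj⟩, rfl⟩
          · rintro ⟨⟨h1, -⟩, h2⟩; exact ⟨h1, h2⟩
      _ ≤ _ := by
          have : (T.card : ℝ) ≤ K := by exact_mod_cast hT
          have h3 : 0 ≤ 3 * g * t := by linarith
          gcongr
  -- the uncaptured buckets of `H`
  have hexch : ∑ j ∈ H.image h \ T, |y j| ^ q ≤
      ∑ j ∈ T \ H.image h, |y j| ^ q + ((1 + ε / 5) ^ q - 1) * (4 * t) := by
    -- Both sides of `happrox` contain the buckets outside `T` and outside the image of `H`;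
    -- cancelling them leaves the exchange inequality.
    have h1 : ∑ j ∈ H.image h \ T, |y j| ^ q + ∑ j ∈ (H.image h)ᶜ \ T, |y j| ^ q =
        ∑ j ∈ Tᶜ, |y j| ^ q := by
      rw [← Finset.sum_union]
      · congr 1; ext j; simp only [Finset.mem_union, Finset.mem_sdiff, Finset.mem_compl]; tauto
      · rw [Finset.disjoint_left]; intro j; simp only [Finset.mem_sdiff, Finset.mem_compl]; tauto
    have h2 : ∑ j ∈ T \ H.image h, |y j| ^ q + ∑ j ∈ (H.image h)ᶜ \ T, |y j| ^ q =
        ∑ j ∈ (H.image h)ᶜ, |y j| ^ q := by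
      rw [← Finset.sum_union]
      · congr 1; ext j; simp only [Finset.mem_union, Finset.mem_sdiff, Finset.mem_compl]; tauto
      · rw [Finset.disjoint_left]; intro j; simp only [Finset.mem_sdiff, Finset.mem_compl]; tauto
    have h3 := mul_le_mul_of_nonneg_left hmass (sub_nonneg.2 hβ)
    linarith
  have hheavy : ∀ i ∈ H, h i ∉ T → |x i| ^ q ≤ |y (h i)| ^ q + (5 + ε) * g * t := by
    intro i hi hiT
    -- This gives `A = 2(1 + ε/5)` in `pow_le_add_of_le_add`, and `2A + 1 ≤ 5 + ε`.
    have h1 : |y (h i)| ^ q ≤ (2 * (1 + ε / 5)) ^ 2 * t := by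
      have ha : |y (h i)| ^ q ≤ ∑ j ∈ Tᶜ, |y j| ^ q :=
        Finset.single_le_sum (f := fun j => |y j| ^ q) (fun j _ => hYnn j)
          (Finset.mem_compl.2 hiT)
      have hb : (1 + ε / 5) ^ q ≤ (1 + ε / 5) ^ 2 := by
        refine pow_le_pow_right₀ (by linarith) ?_
        rcases hpq with ⟨-, rfl⟩ | ⟨-, rfl⟩ <;> norm_num
      calc _ ≤ _ := ha.trans happrox
        _ ≤ (1 + ε / 5) ^ 2 * (4 * t) := by gcongr
        _ = _ := by ring
    have h3 : |x i| ≤ |y (h i)| + |bucketNoise h σ L x (h i)| := by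
      have : σ i * x i = y (h i) - bucketNoise h σ L x (h i) := by
        rw [hy, hashMatrix_mulVec_of_mem hL x (hHL hi)]; ring
      calc |x i| = |σ i * x i| := by rw [abs_mul, hσ, one_mul]
        _ ≤ _ := by rw [this]; exact abs_sub _ _
    have := pow_le_add_of_le_add hpq (abs_nonneg _) ht0 hg hg1
      (by positivity) h3 h1 (hnoise (h i))
    nlinarith [mul_nonneg hε hgt]
  have hH' : ∑ i ∈ H with h i ∉ T, |x i| ^ q ≤
      ∑ j ∈ H.image h \ T, |y j| ^ q + k * ((5 + ε) * g * t) := by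
    have hc : 0 ≤ (5 + ε) * g * t := by positivity
    calc ∑ i ∈ H with h i ∉ T, |x i| ^ q
        ≤ ∑ i ∈ H with h i ∉ T, (|y (h i)| ^ q + (5 + ε) * g * t) :=
          Finset.sum_le_sum fun i hi => hheavy i (Finset.mem_filter.1 hi).1
            (Finset.mem_filter.1 hi).2
      _ = ∑ j ∈ H.image h \ T, |y j| ^ q +
            (H.filter fun i => h i ∉ T).card * ((5 + ε) * g * t) := by
          rw [Finset.sum_add_distrib, Finset.sum_const, nsmul_eq_mul]
          congr 1
          have himg : H.image h \ T = (H.filter fun i => h i ∉ T).image h := by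
            ext j; simp only [Finset.mem_sdiff, Finset.mem_image, Finset.mem_filter]
            constructor
            · rintro ⟨⟨i, hi, rfl⟩, hj⟩; exact ⟨i, ⟨hi, hj⟩, rfl⟩
            · rintro ⟨i, ⟨hi, hj⟩, rfl⟩; exact ⟨⟨i, hi, rfl⟩, hj⟩
          rw [himg, Finset.sum_image]
          intro a ha b hb hab
          exact hL (hHL (Finset.mem_filter.1 ha).1) (hHL (Finset.mem_filter.1 hb).1) hab
      _ ≤ _ := by
          have : ((H.filter fun i => h i ∉ T).card : ℝ) ≤ k := by
            exact_mod_cast (Finset.card_filter_le _ _).trans hH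
          gcongr
  have hsum1 : ∑ i with h i ∉ T, |x i| ^ q =
      ∑ i ∈ H with h i ∉ T, |x i| ^ q + ∑ i ∈ Hᶜ with h i ∉ T, |x i| ^ q := by
    simp only [Finset.sum_filter]
    exact (Finset.sum_add_sum_compl H _).symm
  -- The light mass inside `T`, which pays for the lost part of `H`, and the light mass outside `T`
  -- add up to exactly `t`: this gives the leading constant 1.
  have hsum2 : ∑ i ∈ Hᶜ with h i ∈ T, |x i| ^ q + ∑ i ∈ Hᶜ with h i ∉ T, |x i| ^ q = t :=
    Finset.sum_filter_add_sum_filter_not _ _ _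
  linarith

/-- The tail of the part of `x` in a slot that meets only one bucket. -/
lemma tailNorm_slotPart_pow_le {p : ℝ≥0∞} {q K : ℕ} (hpq : IsExponent p q) (x : Fin n → ℝ)
    (hL : Set.InjOn h L) {f : Fin n → Option (Fin K)} {l : Fin K} {r : ℝ} (hr : 0 ≤ r)
    (hf : ∀ i i', f i = some l → f i' = some l → h i = h i')
    (hnoise : ∀ j, ∑ i ∈ Lᶜ with h i = j, |x i| ^ q ≤ r) :
    tailNorm p 1 (slotPart f l x) ^ q ≤ r := by
  -- The slot meets one bucket and the hash is injective on `L`, so deleting the slot's elements of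
  -- `L` is an admissible choice for the 1-sparse tail.
  have hcard : (L.filter fun i => f i = some l).card ≤ 1 := by
    rw [Finset.card_le_one]
    intro a ha b hb
    rw [Finset.mem_filter] at ha hb
    exact hL ha.1 hb.1 (hf a b ha.2 hb.2)
  refine (tailNorm_pow_le hpq _ hcard).trans ?_
  have hle : ∀ i ∈ (L.filter fun i => f i = some l)ᶜ, |slotPart f l x i| ^ q =
      if i ∈ Lᶜ ∧ f i = some l then |x i| ^ q else 0 := by
    intro i hi
    simp only [Finset.mem_compl, Finset.mem_filter, not_and] at hi ⊢
    by_cases hl : f i = some l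
    · have : i ∉ L := fun h => hi h hl
      simp [slotPart, hl, this]
    · simp [slotPart, hl, hpq.ne_zero]
  rw [Finset.sum_congr rfl hle, ← Finset.sum_filter]
  by_cases hex : ∃ i, f i = some l
  · obtain ⟨i₀, hi₀⟩ := hex
    refine le_trans ?_ (hnoise (h i₀))
    refine Finset.sum_le_sum_of_subset_of_nonneg ?_ fun _ _ _ => by positivity
    intro i hi
    simp only [Finset.mem_filter] at hi ⊢
    exact ⟨hi.2.1, hf _ _ hi.2.2 hi₀⟩
  · push Not at hex
    rw [Finset.sum_eq_zero]
    · exact hr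
    · intro i hi
      exact absurd (Finset.mem_filter.1 hi).2.2 (hex i)

end Deterministic

/-- A set of at most `K` buckets can be assigned to `K` slots. -/
lemma exists_slots (N K : ℕ) : ∃ e : Finset (Fin N) → Fin N → Option (Fin K),
    ∀ T : Finset (Fin N), T.card ≤ K →
      (∀ j, e T j = none ↔ j ∉ T) ∧
        ∀ j j' l, e T j = some l → e T j' = some l → j = j' := by
  suffices hT : ∀ T : Finset (Fin N), ∃ e : Fin N → Option (Fin K), T.card ≤ K →
      (∀ j, e j = none ↔ j ∉ T) ∧ ∀ j j' l, e j = some l → e j' = some l → j = j' by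
    choose e he using hT
    exact ⟨e, he⟩
  intro T
  by_cases hK : T.card ≤ K
  · obtain ⟨φ⟩ := Function.Embedding.nonempty_of_card_le (α := T) (β := Fin K) (by simpa using hK)
    refine ⟨fun j => if hj : j ∈ T then some (φ ⟨j, hj⟩) else none, fun _ => ⟨fun j => ?_, ?_⟩⟩
    · by_cases hj : j ∈ T <;> simp [hj]
    · intro j j' l h1 h2
      by_cases hj : j ∈ T
      · by_cases hj' : j' ∈ T
        · simp only [hj, hj', dif_pos, Option.some.injEq] at h1 h2
          simpa using φ.injective (h1.trans h2.symm)
        · simp [hj'] at h2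
      · simp [hj] at h1
  · exact ⟨fun _ => none, fun h => absurd h hK⟩

/-! ### Moments of random signed sums -/

/-- Resampling one coordinate preserves the uniform distribution: exchanging the old and the new
value is an involution on pairs. -/
lemma sum_sum_update {ι α : Type*} [Fintype ι] [DecidableEq ι] [Fintype α] (i : ι)
    (f : (ι → α) → ℝ) :
    ∑ h, ∑ c, f (Function.update h i c) = Fintype.card α * ∑ h, f h := by
  have hinv : Function.Involutive
      fun z : (ι → α) × α => (Function.update z.1 i z.2, z.1 i) := by
    rintro ⟨h, c⟩
    simp
  rw [← Fintype.sum_prod_type' (f := fun h c => f (Function.update h i c)),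
    ← Equiv.sum_comp hinv.toPerm]
  simp [Function.Involutive.toPerm, Fintype.sum_prod_type, Finset.mul_sum]

/-- The sign that a Boolean stands for. -/
def sgn (b : Bool) : ℝ := if b then 1 else -1

lemma abs_sgn (b : Bool) : |sgn b| = 1 := by cases b <;> simp [sgn]

section Signs

variable {ι : Type*} [Fintype ι] [DecidableEq ι]

lemma sum_signs_insert {B : Finset ι} {a : ι} (ha : a ∉ B) (x : ι → ℝ) (F : ℝ → ℝ) :
    2 * ∑ σ : ι → Bool, F (∑ i ∈ insert a B, sgn (σ i) * x i) =
      ∑ σ : ι → Bool, (F (x a + ∑ i ∈ B, sgn (σ i) * x i) +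
        F (-x a + ∑ i ∈ B, sgn (σ i) * x i)) := by
  have h := sum_sum_update (α := Bool) a
    fun σ : ι → Bool => F (∑ i ∈ insert a B, sgn (σ i) * x i)
  rw [Fintype.card_bool, Nat.cast_ofNat] at h
  rw [← h]
  refine Finset.sum_congr rfl fun σ _ => ?_
  have hB : ∀ c, ∑ i ∈ B, sgn (Function.update σ a c i) * x i = ∑ i ∈ B, sgn (σ i) * x i :=
    fun c => Finset.sum_congr rfl fun i hi => by
      rw [Function.update_of_ne (ne_of_mem_of_not_mem hi ha)]
  simp only [Fintype.sum_bool, Finset.sum_insert ha, hB, Function.update_self]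
  simp [sgn]

lemma sum_signs_sq (B : Finset ι) (x : ι → ℝ) :
    ∑ σ : ι → Bool, (∑ i ∈ B, sgn (σ i) * x i) ^ 2 =
      Fintype.card (ι → Bool) * ∑ i ∈ B, x i ^ 2 := by
  induction B using Finset.induction_on with
  | empty => simp
  | insert a B ha ih =>
    have h := sum_signs_insert ha x fun s => s ^ 2
    have h2 : ∀ s : ℝ, (x a + s) ^ 2 + (-x a + s) ^ 2 = 2 * s ^ 2 + 2 * x a ^ 2 := by
      intro s; ring
    simp only [h2] at h
    rw [Finset.sum_add_distrib, ← Finset.mul_sum, ih, Finset.sum_const, nsmul_eq_mul,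
      Finset.card_univ] at h
    rw [Finset.sum_insert ha]
    linarith

/-- Odd powers of the new sign cancel, so with `V` the sum of squares over `B` the induction reduces
to `3V² + 6x²V + x⁴ ≤ 3(V + x²)²`. -/
lemma sum_signs_pow_four_le (B : Finset ι) (x : ι → ℝ) :
    ∑ σ : ι → Bool, (∑ i ∈ B, sgn (σ i) * x i) ^ 4 ≤
      3 * (Fintype.card (ι → Bool) * (∑ i ∈ B, x i ^ 2) ^ 2) := by
  induction B using Finset.induction_on with
  | empty => simp
  | insert a B ha ih =>
    have h := sum_signs_insert ha x fun s => s ^ 4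
    have h2 : ∀ s : ℝ, (x a + s) ^ 4 + (-x a + s) ^ 4 =
        2 * s ^ 4 + 12 * x a ^ 2 * s ^ 2 + 2 * x a ^ 4 := by
      intro s; ring
    simp only [h2] at h
    rw [Finset.sum_add_distrib, Finset.sum_add_distrib, ← Finset.mul_sum, ← Finset.mul_sum,
      sum_signs_sq, Finset.sum_const, nsmul_eq_mul, Finset.card_univ] at h
    rw [Finset.sum_insert ha]
    have hc : (0 : ℝ) ≤ Fintype.card (ι → Bool) * x a ^ 4 := by positivity
    nlinarith

end Signs

/-! ### Collisions of a random hash function -/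

section Hashing

variable {ι : Type*} [Fintype ι] [DecidableEq ι] {N : ℕ}

lemma card_collision {i i' : ι} (hne : i ≠ i') :
    (N : ℝ) * ∑ h : ι → Fin N, (if h i = h i' then (1 : ℝ) else 0) =
      Fintype.card (ι → Fin N) := by
  have h := sum_sum_update (α := Fin N) i
    fun h : ι → Fin N => if h i = h i' then (1 : ℝ) else 0
  rw [Fintype.card_fin] at h
  rw [← h]
  simp [Function.update_of_ne hne.symm]

lemma card_collision_le (hN : 0 < N) (i i' : ι) :
    ∑ h : ι → Fin N, (if h i' = h i then (1 : ℝ) else 0) ≤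
      Fintype.card (ι → Fin N) * ((if i' = i then 1 else 0) + 1 / N) := by
  have hN' : (0 : ℝ) < N := by exact_mod_cast hN
  by_cases hne : i' = i
  · subst hne
    have : (0 : ℝ) ≤ Fintype.card (ι → Fin N) * (1 / N) := by positivity
    simp only [if_true, Finset.sum_const, nsmul_eq_mul, Finset.card_univ]
    linarith
  · rw [if_neg hne, zero_add, ← card_collision hne]
    apply le_of_eq
    field_simp

/-- Expanding the squares gives a sum over colliding pairs. The diagonal is at most `τ t²` because
all weights are light, and distinct pairs collide with probability `1/N`. -/
lemma sum_sq_bucket_le (hN : 0 < N) (R : Finset ι) (w : ι → ℝ) (hw : ∀ i, 0 ≤ w i) {τ t : ℝ}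
    (hτ : ∀ i ∈ R, w i ≤ τ * t) (ht : ∑ i ∈ R, w i ≤ t) (hτ0 : 0 ≤ τ) :
    ∑ h : ι → Fin N, ∑ j, (∑ i ∈ R with h i = j, w i) ^ 2 ≤
      Fintype.card (ι → Fin N) * ((τ + 1 / N) * t ^ 2) := by
  have hN' : (0 : ℝ) < N := by exact_mod_cast hN
  have ht0 : 0 ≤ ∑ i ∈ R, w i := Finset.sum_nonneg fun i _ => hw i
  have hexp : ∀ h : ι → Fin N, ∑ j, (∑ i ∈ R with h i = j, w i) ^ 2 =
      ∑ i ∈ R, ∑ i' ∈ R, w i * w i' * (if h i' = h i then 1 else 0) := by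
    intro h
    simp only [Finset.sum_filter, sq, Finset.sum_mul_sum]
    rw [Finset.sum_comm]
    refine Finset.sum_congr rfl fun i _ => ?_
    rw [Finset.sum_comm]
    refine Finset.sum_congr rfl fun i' _ => ?_
    simp [eq_comm]
  simp only [hexp]
  rw [Finset.sum_comm]
  calc ∑ i ∈ R, ∑ h : ι → Fin N, ∑ i' ∈ R, w i * w i' * (if h i' = h i then 1 else 0)
      = ∑ i ∈ R, ∑ i' ∈ R, w i * w i' *
          ∑ h : ι → Fin N, (if h i' = h i then (1 : ℝ) else 0) := by
        refine Finset.sum_congr rfl fun i _ => ?_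
        rw [Finset.sum_comm]
        simp only [Finset.mul_sum]
    _ ≤ ∑ i ∈ R, ∑ i' ∈ R, w i * w i' *
          (Fintype.card (ι → Fin N) * ((if i' = i then 1 else 0) + 1 / N)) := by
        refine Finset.sum_le_sum fun i _ => Finset.sum_le_sum fun i' _ => ?_
        exact mul_le_mul_of_nonneg_left (card_collision_le hN i i') (mul_nonneg (hw i) (hw i'))
    _ = Fintype.card (ι → Fin N) * (∑ i ∈ R, w i * w i + (∑ i ∈ R, w i) ^ 2 / N) := by
        simp only [mul_add, Finset.sum_add_distrib]
        congr 1
        · rw [Finset.mul_sum]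
          refine Finset.sum_congr rfl fun i hi => ?_
          simp [hi]; ring
        · rw [sq, Finset.sum_mul_sum, Finset.sum_div, Finset.mul_sum]
          refine Finset.sum_congr rfl fun i hi => ?_
          rw [Finset.sum_div, Finset.mul_sum]
          refine Finset.sum_congr rfl fun i' hi' => ?_
          ring
    _ ≤ _ := by
        refine mul_le_mul_of_nonneg_left ?_ (Nat.cast_nonneg _)
        have h1 : ∑ i ∈ R, w i * w i ≤ τ * t * t := by
          calc ∑ i ∈ R, w i * w i ≤ ∑ i ∈ R, τ * t * w i :=
                Finset.sum_le_sum fun i hi => mul_le_mul_of_nonneg_right (hτ i hi) (hw i)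
            _ = τ * t * ∑ i ∈ R, w i := by rw [Finset.mul_sum]
            _ ≤ _ := mul_le_mul_of_nonneg_left ht (mul_nonneg hτ0 (ht0.trans ht))
        have h2 : (∑ i ∈ R, w i) ^ 2 / N ≤ t ^ 2 / N := by gcongr
        calc _ ≤ τ * t * t + t ^ 2 / N := add_le_add h1 h2
          _ = _ := by ring

/-- Birthday bound: a union bound over the pairs in `L`. -/
lemma card_not_injOn_le (hN : 0 < N) (L : Finset ι) :
    (((Finset.univ : Finset (ι → Fin N)).filter fun h => ¬ Set.InjOn h L).card : ℝ) ≤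
      Fintype.card (ι → Fin N) * ((L.card : ℝ) ^ 2 / N) := by
  have hN' : (0 : ℝ) < N := by exact_mod_cast hN
  rw [Finset.card_filter]
  push_cast
  calc ∑ h : ι → Fin N, (if ¬ Set.InjOn h L then (1 : ℝ) else 0)
      ≤ ∑ h : ι → Fin N, ∑ i ∈ L, ∑ i' ∈ L.erase i, (if h i' = h i then (1 : ℝ) else 0) := by
        refine Finset.sum_le_sum fun h _ => ?_
        have hnn : ∀ i i', (0 : ℝ) ≤ if h i' = h i then (1 : ℝ) else 0 := fun i i' => by
          split_ifs <;> norm_num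
        split_ifs with hinj
        · exact Finset.sum_nonneg fun i _ => Finset.sum_nonneg fun i' _ => hnn i i'
        · simp only [Set.InjOn, not_forall] at hinj
          obtain ⟨a, ha, b, hb, hab, hne⟩ := hinj
          calc (1 : ℝ) = if h b = h a then (1 : ℝ) else 0 := by simp [hab]
            _ ≤ ∑ i' ∈ L.erase a, (if h i' = h a then (1 : ℝ) else 0) :=
                Finset.single_le_sum (f := fun i' => if h i' = h a then (1 : ℝ) else 0)
                  (fun i' _ => hnn a i') (Finset.mem_erase.2 ⟨Ne.symm hne, hb⟩)
            _ ≤ _ := Finset.single_le_sum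
                (f := fun i => ∑ i' ∈ L.erase i, if h i' = h i then (1 : ℝ) else 0)
                (fun i _ => Finset.sum_nonneg fun i' _ => hnn i i') ha
    _ = ∑ i ∈ L, ∑ i' ∈ L.erase i, ∑ h : ι → Fin N, (if h i' = h i then (1 : ℝ) else 0) := by
        rw [Finset.sum_comm]
        exact Finset.sum_congr rfl fun i _ => Finset.sum_comm
    _ ≤ ∑ i ∈ L, ∑ i' ∈ L.erase i, Fintype.card (ι → Fin N) * (1 / N : ℝ) := by
        refine Finset.sum_le_sum fun i _ => Finset.sum_le_sum fun i' hi' => ?_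
        simpa [(Finset.mem_erase.1 hi').1] using card_collision_le hN i i'
    _ ≤ ∑ i ∈ L, ∑ i' ∈ L, Fintype.card (ι → Fin N) * (1 / N : ℝ) := by
        refine Finset.sum_le_sum fun i _ => ?_
        exact Finset.sum_le_sum_of_subset_of_nonneg (Finset.erase_subset _ _)
          fun _ _ _ => by positivity
    _ = _ := by simp only [Finset.sum_const, nsmul_eq_mul]; ring

end Hashing

/-- Markov's inequality for the counting measure of a finite type. -/
lemma card_lt_le_of_sum_le {Θ : Type*} [Fintype Θ] {f : Θ → ℝ} (hf : ∀ θ, 0 ≤ f θ) {a δ : ℝ}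
    (ha : 0 ≤ a) (hδ : 0 ≤ δ) (hsum : ∑ θ, f θ ≤ Fintype.card Θ * (δ * a)) :
    ((Finset.univ.filter fun θ => a < f θ).card : ℝ) ≤ δ * Fintype.card Θ := by
  -- The threshold is 0 when the tail of `x` vanishes; then `f` is identically 0 and the strict
  -- inequality never holds.
  rcases ha.eq_or_lt with rfl | ha
  · have h0 : ∀ θ, f θ = 0 := by
      have : ∑ θ, f θ = 0 :=
        le_antisymm (by simpa using hsum) (Finset.sum_nonneg fun θ _ => hf θ)
      intro θ
      exact (Finset.sum_eq_zero_iff_of_nonneg fun θ _ => hf θ).1 this θ (Finset.mem_univ θ)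
    simp only [h0, lt_irrefl, Finset.filter_false, Finset.card_empty, Nat.cast_zero]
    positivity
  · have h1 : a * ((Finset.univ.filter fun θ => a < f θ).card : ℝ) ≤ ∑ θ, f θ := by
      calc a * ((Finset.univ.filter fun θ => a < f θ).card : ℝ)
          = ∑ θ with a < f θ, a := by rw [Finset.sum_const, nsmul_eq_mul, mul_comm]
        _ ≤ ∑ θ with a < f θ, f θ :=
            Finset.sum_le_sum fun θ hθ => (Finset.mem_filter.1 hθ).2.le
        _ ≤ _ := Finset.sum_le_sum_of_subset_of_nonneg (Finset.filter_subset _ _)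
            fun θ _ _ => hf θ
    refine le_of_mul_le_mul_left ?_ ha
    calc _ ≤ _ := h1.trans hsum
      _ = _ := by ring

/-! ### A random signed hash is good with constant probability -/

/-- A hash function together with a choice of signs. -/
abbrev SignedHash (n N : ℕ) : Type := (Fin n → Fin N) × (Fin n → Bool)

/-- The sketching matrix of a signed hash function. -/
abbrev SignedHash.matrix {n N : ℕ} (θ : SignedHash n N) : Matrix (Fin N) (Fin n) ℝ :=
  hashMatrix θ.1 fun i => sgn (θ.2 i)

/-- The signed hash function isolates the coordinates in `L`, has little noise in every bucket,
and does not blow up the coordinates outside `H`. -/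
structure SignedHash.Good {n N : ℕ} (q : ℕ) (x : Fin n → ℝ) (H L : Finset (Fin n)) (g : ℝ)
    (θ : SignedHash n N) : Prop where
  injOn : Set.InjOn θ.1 L
  bucket_le : ∀ j, ∑ i ∈ Lᶜ with θ.1 i = j, |x i| ^ q ≤ g ^ 2 * ∑ i ∈ Hᶜ, |x i| ^ q
  noise_le : ∀ j, |bucketNoise θ.1 (fun i => sgn (θ.2 i)) L x j| ^ q ≤
    g ^ 2 * ∑ i ∈ Hᶜ, |x i| ^ q
  mass_le : ∑ j ∈ (H.image θ.1)ᶜ, |(θ.matrix *ᵥ x) j| ^ q ≤ 4 * ∑ i ∈ Hᶜ, |x i| ^ q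

lemma sum_signs_bucketNoise_sq {n N : ℕ} (h : Fin n → Fin N) (L : Finset (Fin n))
    (x : Fin n → ℝ) (j : Fin N) :
    ∑ σ : Fin n → Bool, bucketNoise h (fun i => sgn (σ i)) L x j ^ 2 =
      Fintype.card (Fin n → Bool) * ∑ i ∈ Lᶜ with h i = j, |x i| ^ 2 := by
  simp only [sq_abs]
  exact sum_signs_sq _ x

lemma sum_signs_bucketNoise_pow_four_le {n N : ℕ} (h : Fin n → Fin N) (L : Finset (Fin n))
    (x : Fin n → ℝ) (j : Fin N) :
    ∑ σ : Fin n → Bool, bucketNoise h (fun i => sgn (σ i)) L x j ^ 4 ≤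
      3 * (Fintype.card (Fin n → Bool) * (∑ i ∈ Lᶜ with h i = j, |x i| ^ 2) ^ 2) := by
  simp only [sq_abs]
  exact sum_signs_pow_four_le _ x

lemma abs_bucketNoise_le {n N : ℕ} (h : Fin n → Fin N) (σ : Fin n → Bool)
    (L : Finset (Fin n)) (x : Fin n → ℝ) (j : Fin N) :
    |bucketNoise h (fun i => sgn (σ i)) L x j| ≤ ∑ i ∈ Lᶜ with h i = j, |x i| := by
  refine (Finset.abs_sum_le_sum_abs _ _).trans_eq (Finset.sum_congr rfl fun i _ => ?_)
  rw [abs_mul, abs_sgn, one_mul]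

lemma sum_sum_bucket {n N : ℕ} (h : Fin n → Fin N) (R : Finset (Fin n)) (w : Fin n → ℝ) :
    ∑ j, ∑ i ∈ R with h i = j, w i = ∑ i ∈ R, w i :=
  Finset.sum_fiberwise _ _ _

lemma sum_image_compl_le {n N : ℕ} (q : ℕ) (θ : SignedHash n N) (H : Finset (Fin n))
    (x : Fin n → ℝ) :
    ∑ j ∈ (H.image θ.1)ᶜ, |(θ.matrix *ᵥ x) j| ^ q ≤
      ∑ j, |bucketNoise θ.1 (fun i => sgn (θ.2 i)) H x j| ^ q := by
  calc ∑ j ∈ (H.image θ.1)ᶜ, |(θ.matrix *ᵥ x) j| ^ q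
      = ∑ j ∈ (H.image θ.1)ᶜ, |bucketNoise θ.1 (fun i => sgn (θ.2 i)) H x j| ^ q := by
        refine Finset.sum_congr rfl fun j hj => ?_
        rw [hashMatrix_mulVec_of_forall_ne x]
        rintro i hi rfl
        exact Finset.mem_compl.1 hj (Finset.mem_image_of_mem _ hi)
    _ ≤ _ := Finset.sum_le_sum_of_subset_of_nonneg (Finset.subset_univ _)
        fun _ _ _ => by positivity

lemma le_of_sum_sq_le {ι : Type*} [Fintype ι] {f : ι → ℝ} {r : ℝ} (hr : 0 ≤ r)
    (h : ∑ j, f j ^ 2 ≤ r ^ 2) (j : ι) : f j ≤ r :=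
  le_of_sq_le_sq ((Finset.single_le_sum (f := fun j => f j ^ 2) (fun _ _ => sq_nonneg _)
    (Finset.mem_univ j)).trans h) hr

section Probability

variable {n N : ℕ} {p : ℝ≥0∞} {q : ℕ} (x : Fin n → ℝ) {H L : Finset (Fin n)} {g τ : ℝ}

/-- Markov's inequality is applied to the sum of squares over all buckets, which controls every
bucket at once without a union bound over `N`. -/
lemma card_bucket_gt_le (hN : 0 < N) (hHL : H ⊆ L) (hτ0 : 0 ≤ τ)
    (hτ : ∀ i ∈ Lᶜ, |x i| ^ q ≤ τ * ∑ i ∈ Hᶜ, |x i| ^ q) (hg : τ + 1 / N ≤ g ^ 4 / 200) :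
    ((Finset.univ.filter fun θ : SignedHash n N => (g ^ 2 * ∑ i ∈ Hᶜ, |x i| ^ q) ^ 2 <
      ∑ j, (∑ i ∈ Lᶜ with θ.1 i = j, |x i| ^ q) ^ 2).card : ℝ) ≤
        1 / 200 * Fintype.card (SignedHash n N) := by
  refine card_lt_le_of_sum_le (fun θ => Finset.sum_nonneg fun _ _ => sq_nonneg _) (sq_nonneg _)
    (by norm_num) ?_
  have h := sum_sq_bucket_le hN Lᶜ (fun i => |x i| ^ q) (fun i => by positivity) hτ
    (Finset.sum_le_sum_of_subset_of_nonneg (Finset.compl_subset_compl.2 hHL)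
      fun i _ _ => by positivity) hτ0
  rw [Fintype.sum_prod_type, Fintype.card_prod]
  simp only [Finset.sum_const, nsmul_eq_mul, Finset.card_univ]
  rw [← Finset.mul_sum]
  push_cast only [Nat.cast_mul]
  set t := ∑ i ∈ Hᶜ, |x i| ^ q
  have h2 : (τ + 1 / N) * t ^ 2 ≤ 1 / 200 * (g ^ 2 * t) ^ 2 := by
    calc _ ≤ g ^ 4 / 200 * t ^ 2 := mul_le_mul_of_nonneg_right hg (sq_nonneg _)
      _ = _ := by ring
  calc _ ≤ (Fintype.card (Fin n → Bool) : ℝ) *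
        (Fintype.card (Fin n → Fin N) * ((τ + 1 / N) * t ^ 2)) :=
        mul_le_mul_of_nonneg_left h (Nat.cast_nonneg _)
    _ ≤ (Fintype.card (Fin n → Bool) : ℝ) *
        (Fintype.card (Fin n → Fin N) * (1 / 200 * (g ^ 2 * t) ^ 2)) := by gcongr
    _ = _ := by ring

/-- Second moments summed over the buckets give the whole light mass, which is not small. Fourth
moments reduce to squared bucket masses, whose expected sum is at most `(τ + 1/N) t²`. -/
lemma card_noise_gt_le (hN : 0 < N) (hHL : H ⊆ L) (hτ0 : 0 ≤ τ)
    (hτ : ∀ i ∈ Lᶜ, |x i| ^ 2 ≤ τ * ∑ i ∈ Hᶜ, |x i| ^ 2) (hg : τ + 1 / N ≤ g ^ 4 / 200) :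
    ((Finset.univ.filter fun θ : SignedHash n N => (g ^ 2 * ∑ i ∈ Hᶜ, |x i| ^ 2) ^ 2 <
      ∑ j, bucketNoise θ.1 (fun i => sgn (θ.2 i)) L x j ^ 4).card : ℝ) ≤
        3 / 200 * Fintype.card (SignedHash n N) := by
  refine card_lt_le_of_sum_le (fun θ => Finset.sum_nonneg fun _ _ => by positivity) (sq_nonneg _)
    (by norm_num) ?_
  have h := sum_sq_bucket_le hN Lᶜ (fun i => |x i| ^ 2) (fun i => by positivity) hτ
    (Finset.sum_le_sum_of_subset_of_nonneg (Finset.compl_subset_compl.2 hHL)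
      fun i _ _ => by positivity) hτ0
  rw [Fintype.sum_prod_type, Fintype.card_prod]
  push_cast only [Nat.cast_mul]
  set t := ∑ i ∈ Hᶜ, |x i| ^ 2
  have h2 : (τ + 1 / N) * t ^ 2 ≤ 1 / 200 * (g ^ 2 * t) ^ 2 := by
    calc _ ≤ g ^ 4 / 200 * t ^ 2 := mul_le_mul_of_nonneg_right hg (sq_nonneg _)
      _ = _ := by ring
  calc ∑ h : Fin n → Fin N, ∑ σ : Fin n → Bool,
          ∑ j, bucketNoise h (fun i => sgn (σ i)) L x j ^ 4
      ≤ ∑ h : Fin n → Fin N, ∑ j, 3 * (Fintype.card (Fin n → Bool) *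
          (∑ i ∈ Lᶜ with h i = j, |x i| ^ 2) ^ 2) := by
        refine Finset.sum_le_sum fun h _ => ?_
        rw [Finset.sum_comm]
        exact Finset.sum_le_sum fun j _ => sum_signs_bucketNoise_pow_four_le h L x j
    _ = 3 * (Fintype.card (Fin n → Bool) * ∑ h : Fin n → Fin N, ∑ j,
          (∑ i ∈ Lᶜ with h i = j, |x i| ^ 2) ^ 2) := by simp only [Finset.mul_sum]
    _ ≤ 3 * ((Fintype.card (Fin n → Bool) : ℝ) *
        (Fintype.card (Fin n → Fin N) * ((τ + 1 / N) * t ^ 2))) := by gcongr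
    _ ≤ 3 * ((Fintype.card (Fin n → Bool) : ℝ) *
        (Fintype.card (Fin n → Fin N) * (1 / 200 * (g ^ 2 * t) ^ 2))) := by gcongr
    _ = _ := by ring

lemma card_mass_gt_le :
    ((Finset.univ.filter fun θ : SignedHash n N => 4 * ∑ i ∈ Hᶜ, |x i| ^ 2 <
      ∑ j, bucketNoise θ.1 (fun i => sgn (θ.2 i)) H x j ^ 2).card : ℝ) ≤
        1 / 4 * Fintype.card (SignedHash n N) := by
  have ht : 0 ≤ ∑ i ∈ Hᶜ, |x i| ^ 2 := Finset.sum_nonneg fun _ _ => by positivity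
  refine card_lt_le_of_sum_le (fun θ => Finset.sum_nonneg fun _ _ => sq_nonneg _) (by linarith)
    (by norm_num) (le_of_eq ?_)
  rw [Fintype.sum_prod_type, Fintype.card_prod]
  push_cast only [Nat.cast_mul]
  -- For every fixed hash function the signs remove the cross terms, so the expected mass is exactly
  -- `t`.
  have h1 : ∀ h : Fin n → Fin N, ∑ σ : Fin n → Bool,
      ∑ j, bucketNoise h (fun i => sgn (σ i)) H x j ^ 2 =
        Fintype.card (Fin n → Bool) * ∑ i ∈ Hᶜ, |x i| ^ 2 := by
    intro h
    rw [Finset.sum_comm]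
    simp only [sum_signs_bucketNoise_sq]
    rw [← Finset.mul_sum, sum_sum_bucket]
  simp only [h1, Finset.sum_const, nsmul_eq_mul, Finset.card_univ]
  ring

lemma card_signedHash_not_injOn_le (hN : 0 < N) (L : Finset (Fin n)) :
    ((Finset.univ.filter fun θ : SignedHash n N => ¬ Set.InjOn θ.1 L).card : ℝ) ≤
      (L.card : ℝ) ^ 2 / N * Fintype.card (SignedHash n N) := by
  have h : (Finset.univ.filter fun θ : SignedHash n N => ¬ Set.InjOn θ.1 L) =
      (Finset.univ.filter fun h : Fin n → Fin N => ¬ Set.InjOn h L) ×ˢ Finset.univ := by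
    ext θ; simp
  rw [h, Finset.card_product, Fintype.card_prod, Finset.card_univ]
  push_cast only [Nat.cast_mul]
  calc _ ≤ _ := mul_le_mul_of_nonneg_right (card_not_injOn_le hN L) (Nat.cast_nonneg _)
    _ = _ := by ring

-- For `q = 2` the budget is `1/50 + 1/200 + 3/200 + 1/4 = 29/100`. For `q = 1` the noise and mass
-- bounds follow from the triangle inequality, and only the first two terms occur.
open Classical in
lemma card_not_good_le (hpq : IsExponent p q) (hN : 0 < N) (hHL : H ⊆ L) (hτ0 : 0 ≤ τ)
    (hτ : ∀ i ∈ Lᶜ, |x i| ^ q ≤ τ * ∑ i ∈ Hᶜ, |x i| ^ q) (hg : τ + 1 / N ≤ g ^ 4 / 200)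
    (hL : (L.card : ℝ) ^ 2 / N ≤ 1 / 50) :
    ((Finset.univ.filter fun θ : SignedHash n N => ¬ θ.Good q x H L g).card : ℝ) ≤
      29 / 100 * Fintype.card (SignedHash n N) := by
  have hinj := card_signedHash_not_injOn_le hN L
  have hinj' := hinj.trans (mul_le_mul_of_nonneg_right hL (Nat.cast_nonneg _))
  have hbuck := card_bucket_gt_le x hN hHL hτ0 hτ hg
  have ht0 : 0 ≤ ∑ i ∈ Hᶜ, |x i| ^ q := Finset.sum_nonneg fun _ _ => by positivity
  have hgt0 : 0 ≤ g ^ 2 * ∑ i ∈ Hᶜ, |x i| ^ q := by positivity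
  set A := Finset.univ.filter fun θ : SignedHash n N => ¬ Set.InjOn θ.1 L with hA
  set B := Finset.univ.filter fun θ : SignedHash n N => (g ^ 2 * ∑ i ∈ Hᶜ, |x i| ^ q) ^ 2 <
      ∑ j, (∑ i ∈ Lᶜ with θ.1 i = j, |x i| ^ q) ^ 2 with hB
  have hBnot : ∀ θ ∉ B, ∀ j, ∑ i ∈ Lᶜ with θ.1 i = j, |x i| ^ q ≤
      g ^ 2 * ∑ i ∈ Hᶜ, |x i| ^ q := by
    intro θ hθ
    simp only [hB, Finset.mem_filter, Finset.mem_univ, true_and, not_lt] at hθ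
    exact le_of_sum_sq_le hgt0 hθ
  have hcard0 : (0 : ℝ) ≤ Fintype.card (SignedHash n N) := Nat.cast_nonneg _
  rcases hpq with ⟨-, rfl⟩ | ⟨-, rfl⟩
  · have hsub : (Finset.univ.filter fun θ : SignedHash n N => ¬ θ.Good 1 x H L g) ⊆ A ∪ B := by
      intro θ hθ
      by_contra hcon
      rw [Finset.mem_union, not_or] at hcon
      refine (Finset.mem_filter.1 hθ).2 ⟨?_, hBnot θ hcon.2, fun j => ?_, ?_⟩
      · simpa [hA] using hcon.1
      · refine le_trans ?_ (hBnot θ hcon.2 j)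
        simpa using abs_bucketNoise_le θ.1 θ.2 L x j
      · refine (sum_image_compl_le 1 θ H x).trans ?_
        calc _ ≤ ∑ j, ∑ i ∈ Hᶜ with θ.1 i = j, |x i| ^ 1 := by
              refine Finset.sum_le_sum fun j _ => ?_
              simpa using abs_bucketNoise_le θ.1 θ.2 H x j
          _ = ∑ i ∈ Hᶜ, |x i| ^ 1 := sum_sum_bucket _ _ _
          _ ≤ _ := by linarith
    have : ((Finset.univ.filter fun θ : SignedHash n N => ¬ θ.Good 1 x H L g).card : ℝ) ≤
        A.card + B.card := by
      exact_mod_cast (Finset.card_le_card hsub).trans (Finset.card_union_le _ _)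
    linarith
  · have hnoise := card_noise_gt_le x hN hHL hτ0 hτ hg
    have hmass := card_mass_gt_le (N := N) (H := H) x
    set C := Finset.univ.filter fun θ : SignedHash n N => (g ^ 2 * ∑ i ∈ Hᶜ, |x i| ^ 2) ^ 2 <
      ∑ j, bucketNoise θ.1 (fun i => sgn (θ.2 i)) L x j ^ 4 with hC
    set D := Finset.univ.filter fun θ : SignedHash n N => 4 * ∑ i ∈ Hᶜ, |x i| ^ 2 <
      ∑ j, bucketNoise θ.1 (fun i => sgn (θ.2 i)) H x j ^ 2 with hD
    have hsub : (Finset.univ.filter fun θ : SignedHash n N => ¬ θ.Good 2 x H L g) ⊆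
        (A ∪ B) ∪ (C ∪ D) := by
      intro θ hθ
      by_contra hcon
      simp only [Finset.mem_union, not_or] at hcon
      obtain ⟨⟨h1, h2⟩, h3, h4⟩ := hcon
      refine (Finset.mem_filter.1 hθ).2 ⟨?_, hBnot θ h2, fun j => ?_, ?_⟩
      · simpa [hA] using h1
      · simp only [hC, Finset.mem_filter, Finset.mem_univ, true_and, not_lt] at h3
        refine le_of_sum_sq_le
          (f := fun j => |bucketNoise θ.1 (fun i => sgn (θ.2 i)) L x j| ^ 2) hgt0 ?_ j
        simpa only [sq_abs, ← pow_mul] using h3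
      · refine (sum_image_compl_le 2 θ H x).trans ?_
        simpa [hD, sq_abs] using h4
    have : ((Finset.univ.filter fun θ : SignedHash n N => ¬ θ.Good 2 x H L g).card : ℝ) ≤
        (A.card + B.card) + (C.card + D.card) := by
      exact_mod_cast (Finset.card_le_card hsub).trans ((Finset.card_union_le _ _).trans
        (add_le_add (Finset.card_union_le _ _) (Finset.card_union_le _ _)))
    linarith

end Probability

/-- The heavy coordinates: there are few coordinates outside `H` that carry more than a `τ`
fraction of the mass outside `H`. -/
lemma exists_heavy {n : ℕ} (w : Fin n → ℝ) (hw : ∀ i, 0 ≤ w i) (H : Finset (Fin n)) {τ : ℝ}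
    (hτ : 0 < τ) :
    ∃ L : Finset (Fin n), H ⊆ L ∧ (L.card : ℝ) ≤ H.card + 1 / τ ∧
      ∀ i ∈ Lᶜ, w i ≤ τ * ∑ i ∈ Hᶜ, w i := by
  set t := ∑ i ∈ Hᶜ, w i with ht
  set G := Hᶜ.filter fun i => τ * t < w i with hG
  have hGt : ∑ i ∈ G, w i ≤ t :=
    Finset.sum_le_sum_of_subset_of_nonneg (Finset.filter_subset _ _) fun i _ _ => hw i
  have ht0 : 0 ≤ t := Finset.sum_nonneg fun i _ => hw i
  refine ⟨H ∪ G, Finset.subset_union_left, ?_, fun i hi => ?_⟩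
  · have hc : (G.card : ℝ) ≤ 1 / τ := by
      rcases ht0.eq_or_lt with h0 | h0
      · have hGe : G = ∅ := by
          rw [Finset.eq_empty_iff_forall_notMem]
          intro i hi
          have h1 := (Finset.mem_filter.1 hi).2
          have h2 := Finset.single_le_sum (fun i _ => hw i) hi
          rw [← h0, mul_zero] at h1
          linarith
        simp [hGe, hτ.le]
      · have h1 : G.card * (τ * t) ≤ ∑ i ∈ G, w i := by
          rw [← nsmul_eq_mul]
          exact Finset.card_nsmul_le_sum _ _ _ fun i hi => (Finset.mem_filter.1 hi).2.le
        rw [le_div_iff₀ hτ]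
        nlinarith
    have : ((H ∪ G).card : ℝ) ≤ H.card + G.card := by exact_mod_cast Finset.card_union_le _ _
    linarith
  · rw [Finset.mem_compl, Finset.mem_union, not_or] at hi
    by_contra hcon
    exact hi.2 (Finset.mem_filter.2 ⟨Finset.mem_compl.2 hi.1, not_le.1 hcon⟩)

/-- Fubini: a guarantee for every fixed input also holds for an input chosen by independent earlier
randomness. -/
lemma prod_real_mem_le {α β F : Type*} [MeasurableSpace α] [MeasurableSpace β] [Finite F]
    (μ : Measure α) (ν : Measure β) [IsProbabilityMeasure μ] [IsProbabilityMeasure ν] {f : α → F}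
    (hf : ∀ t, MeasurableSet {a | f a = t}) {s : F → Set β} (hs : ∀ t, MeasurableSet (s t))
    {δ : ℝ} (hδ : 0 ≤ δ) (h : ∀ t, ν.real (s t) ≤ δ) :
    (μ.prod ν).real {z | z.2 ∈ s (f z.1)} ≤ δ := by
  have hmeas : MeasurableSet {z : α × β | z.2 ∈ s (f z.1)} := by
    have : {z : α × β | z.2 ∈ s (f z.1)} =
        ⋃ t, (Prod.fst ⁻¹' {a | f a = t}) ∩ (Prod.snd ⁻¹' s t) := by
      ext z; simp
    rw [this]
    exact MeasurableSet.iUnion fun t => (measurable_fst (hf t)).inter (measurable_snd (hs t))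
  refine ENNReal.toReal_le_of_le_ofReal hδ ?_
  rw [Measure.prod_apply hmeas]
  calc ∫⁻ a, ν (Prod.mk a ⁻¹' {z | z.2 ∈ s (f z.1)}) ∂μ ≤ ∫⁻ _, ENNReal.ofReal δ ∂μ := by
        refine lintegral_mono fun a => ?_
        rw [← ofReal_measureReal]
        exact ENNReal.ofReal_le_ofReal (h (f a))
    _ = ENNReal.ofReal δ := by simp

lemma prod_real_fst_preimage {α β : Type*} [MeasurableSpace α] [MeasurableSpace β]
    (μ : Measure α) (ν : Measure β) [IsProbabilityMeasure μ] [IsProbabilityMeasure ν]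
    (s : Set α) : (μ.prod ν).real (Prod.fst ⁻¹' s) = μ.real s := by
  rw [← Set.prod_univ, measureReal_prod_prod, probReal_univ, mul_one]

lemma uniform_real {Θ : Type*} [Fintype Θ] [Nonempty Θ] [MeasurableSpace Θ]
    [MeasurableSingletonClass Θ] (P : Θ → Prop) [DecidablePred P] :
    (PMF.uniformOfFintype Θ).toMeasure.real {θ | P θ} =
      (Finset.univ.filter P).card / Fintype.card Θ := by
  rw [measureReal_def, PMF.toMeasure_uniformOfFintype_apply _ (Set.toFinite _).measurableSet]
  simp [Fintype.card_subtype]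

/-! ### Combining the two rounds -/

section Main

variable {n N m₁ m₂ K k : ℕ} {p : ℝ≥0∞} {q : ℕ}

/-- The total error in terms of the tail of the input. -/
lemma error_factor_le (hpq : IsExponent p q) {ε g : ℝ} (hε : 0 ≤ ε)
    (hg : 4 * (K * g ^ 2) + 3 * K * g + k * (5 + ε) * g ≤ ε / 5) :
    (1 + 4 * ((1 + ε / 5) ^ q - 1) + 3 * K * g + k * (5 + ε) * g) + K * (2 ^ q * g ^ 2) ≤
      (1 + ε) ^ q := by
  have hK : 0 ≤ K * g ^ 2 := by positivity
  rcases hpq with ⟨-, rfl⟩ | ⟨-, rfl⟩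
  · simp only [pow_one]
    linarith
  -- The left side is at most `1 + 9ε/5 + 4ε²/25`; running the first round with `ε/5` leaves this
  -- room.
  · nlinarith [sq_nonneg ε]

/-- The failure probabilities are `29/100` for the hash, `1/100` for the first round and `K δ ≤
1/100` for all slots together, less than `1/3` in total. -/
lemma sketchAndRefine_succeeds (hpq : IsExponent p q) {R₁ : OneRoundAlg N m₁}
    {R₂ : OneRoundAlg n m₂} {ε δ g τ : ℝ} (hε : 0 ≤ ε) (hN : 0 < N)
    (hR₁ : R₁.Succeeds p k (ε / 5) (1 / 100)) (hsupp : R₁.SupportBound K)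
    (hR₂ : R₂.Succeeds p 1 1 δ) (hδ : K * δ ≤ 1 / 100) (hg0 : 0 ≤ g) (hg1 : g ≤ 1)
    (hg : 4 * (K * g ^ 2) + 3 * K * g + k * (5 + ε) * g ≤ ε / 5) (hτ0 : 0 < τ)
    (hτ : τ + 1 / N ≤ g ^ 4 / 200) (hL : (k + 1 / τ) ^ 2 / N ≤ 1 / 50) :
    ∃ R : TwoRoundAlg n m₁ (K * m₂), R.Succeeds p k ε (1 / 3) := by
  classical
  have : NeZero N := ⟨hN.ne'⟩
  obtain ⟨e, he⟩ := exists_slots N K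
  set ν : Measure (SignedHash n N) := (PMF.uniformOfFintype (SignedHash n N)).toMeasure with hν
  set gs : SignedHash n N → Finset (Fin N) → Fin n → Option (Fin K) :=
    fun θ T i => e T (θ.1 i) with hgs
  refine ⟨sketchAndRefine ν SignedHash.matrix gs R₁ R₂, fun x => ?_⟩
  obtain ⟨H, hHk, hH⟩ := exists_tailNorm_pow_eq hpq k x
  obtain ⟨L, hHL, hLc, hLt⟩ := exists_heavy (fun i => |x i| ^ q) (fun i => by positivity) H hτ0
  set t := ∑ i ∈ Hᶜ, |x i| ^ q with ht
  have ht0 : 0 ≤ t := Finset.sum_nonneg fun _ _ => by positivity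
  have hLc' : (L.card : ℝ) ^ 2 / N ≤ 1 / 50 := by
    refine le_trans ?_ hL
    have : (L.card : ℝ) ≤ k + 1 / τ := hLc.trans (by gcongr)
    gcongr
  -- the failure events
  set T : SignedHash n N → R₁.Ω → Finset (Fin N) :=
    fun θ ω₁ => supp (R₁.output (θ.matrix *ᵥ x) ω₁) with hTdef
  set B₁ : Set ((SignedHash n N × R₁.Ω) × R₂.Ω) :=
    Prod.fst ⁻¹' (Prod.fst ⁻¹' {θ | ¬ θ.Good q x H L g}) with hB₁
  set s₂ : SignedHash n N → Set R₁.Ω := fun θ => {ω₁ |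
    ¬ pNorm p (R₁.output (θ.matrix *ᵥ x) ω₁ - θ.matrix *ᵥ x) ≤
      (1 + ε / 5) * tailNorm p k (θ.matrix *ᵥ x)} with hs₂
  set B₂ : Set ((SignedHash n N × R₁.Ω) × R₂.Ω) :=
    Prod.fst ⁻¹' {z | z.2 ∈ s₂ (id z.1)} with hB₂
  set s₃ : SignedHash n N × Finset (Fin N) → Set R₂.Ω := fun u => ⋃ l, {ω₂ |
    ¬ pNorm p (R₂.output (slotPart (gs u.1 u.2) l x) ω₂ - slotPart (gs u.1 u.2) l x) ≤
      (1 + 1) * tailNorm p 1 (slotPart (gs u.1 u.2) l x)} with hs₃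
  set B₃ : Set ((SignedHash n N × R₁.Ω) × R₂.Ω) :=
    {z | z.2 ∈ s₃ ((fun y : SignedHash n N × R₁.Ω => (y.1, T y.1 y.2)) z.1)} with hB₃
  have hP₁ : ((ν.prod R₁.μ).prod R₂.μ).real B₁ ≤ 29 / 100 := by
    rw [hB₁, prod_real_fst_preimage, prod_real_fst_preimage, hν, uniform_real,
      div_le_iff₀ (by exact_mod_cast Fintype.card_pos)]
    exact card_not_good_le x hpq hN hHL hτ0.le hLt hτ hLc'
  have hP₂ : ((ν.prod R₁.μ).prod R₂.μ).real B₂ ≤ 1 / 100 := by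
    rw [hB₂, prod_real_fst_preimage]
    refine prod_real_mem_le ν R₁.μ (fun θ => measurableSet_singleton θ) (fun θ => ?_)
      (by norm_num) fun θ => hR₁.measure_far_le hpq _
    exact (R₁.measurableSet_close hpq _ _).compl
  have hP₃ : ((ν.prod R₁.μ).prod R₂.μ).real B₃ ≤ 1 / 100 := by
    refine prod_real_mem_le (ν.prod R₁.μ) R₂.μ
      (f := fun y : SignedHash n N × R₁.Ω => (y.1, T y.1 y.2)) (s := s₃) (δ := 1 / 100)
      (fun u => ?_) (fun u => ?_) (by norm_num) fun u => ?_
    · have : {y : SignedHash n N × R₁.Ω | (y.1, T y.1 y.2) = u} =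
          (Prod.fst ⁻¹' {u.1}) ∩
            (Prod.snd ⁻¹' {ω₁ | supp (R₁.output (u.1.matrix *ᵥ x) ω₁) = u.2}) := by
        ext y
        obtain ⟨θ, T'⟩ := u
        simp only [Set.mem_ofPred_eq, Prod.mk.injEq, Set.mem_inter_iff, Set.mem_preimage,
          Set.mem_singleton_iff, hTdef]
        constructor
        · rintro ⟨rfl, h⟩; exact ⟨rfl, h⟩
        · rintro ⟨rfl, h⟩; exact ⟨rfl, h⟩
      rw [this]
      exact (measurable_fst (measurableSet_singleton _)).inter
        (measurable_snd (measurableSet_eq_supp (R₁.measurable_output _) _))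
    · exact MeasurableSet.iUnion fun l => (R₂.measurableSet_close hpq _ _).compl
    · calc R₂.μ.real (s₃ u) ≤ ∑ l : Fin K, R₂.μ.real {ω₂ |
            ¬ pNorm p (R₂.output (slotPart (gs u.1 u.2) l x) ω₂ - slotPart (gs u.1 u.2) l x) ≤
              (1 + 1) * tailNorm p 1 (slotPart (gs u.1 u.2) l x)} :=
            measureReal_iUnion_fintype_le _
        _ ≤ ∑ _l : Fin K, δ := Finset.sum_le_sum fun l _ => hR₂.measure_far_le hpq _
        _ = K * δ := by simp
        _ ≤ _ := hδ
  -- outside of the failure events the output is good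
  have hgood : ∀ z, z ∉ B₁ → z ∉ B₂ → z ∉ B₃ →
      pNorm p ((sketchAndRefine ν SignedHash.matrix gs R₁ R₂).output x z - x) ≤
        (1 + ε) * tailNorm p k x := by
    rintro ⟨⟨θ, ω₁⟩, ω₂⟩ h1 h2 h3
    have hG : θ.Good q x H L g := by simpa [hB₁] using h1
    have hC₁ : pNorm p (R₁.output (θ.matrix *ᵥ x) ω₁ - θ.matrix *ᵥ x) ≤
        (1 + ε / 5) * tailNorm p k (θ.matrix *ᵥ x) := by simpa [hB₂, hs₂] using h2
    have hC₂ : ∀ l, pNorm p (R₂.output (slotPart (gs θ (T θ ω₁)) l x) ω₂ -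
        slotPart (gs θ (T θ ω₁)) l x) ≤
          (1 + 1) * tailNorm p 1 (slotPart (gs θ (T θ ω₁)) l x) := by
      simpa [hB₃, hs₃] using h3
    have hTK : (T θ ω₁).card ≤ K := hsupp ω₁ _
    obtain ⟨he₁, he₂⟩ := he _ hTK
    have herr := sketchAndRefine_error_le ν SignedHash.matrix gs R₁ R₂ hpq x θ ω₁ ω₂
      (gs θ (T θ ω₁)) rfl
    have hnone : (∑ i with gs θ (T θ ω₁) i = none, |x i| ^ q) =
        ∑ i with θ.1 i ∉ T θ ω₁, |x i| ^ q := by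
      refine Finset.sum_congr ?_ fun _ _ => rfl
      ext i; simp [hgs, he₁]
    have happrox : ∑ j ∈ (T θ ω₁)ᶜ, |(θ.matrix *ᵥ x) j| ^ q ≤
        (1 + ε / 5) ^ q * ∑ j ∈ (H.image θ.1)ᶜ, |(θ.matrix *ᵥ x) j| ^ q := by
      calc ∑ j ∈ (T θ ω₁)ᶜ, |(θ.matrix *ᵥ x) j| ^ q
          = ∑ j ∈ (T θ ω₁)ᶜ, |(R₁.output (θ.matrix *ᵥ x) ω₁ - θ.matrix *ᵥ x) j| ^ q := by
            refine Finset.sum_congr rfl fun j hj => ?_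
            -- Off its support the output is 0, so the recovery error there is the sketch itself.
            have hj0 : R₁.output (θ.matrix *ᵥ x) ω₁ j = 0 := by
              simpa [hTdef, supp] using hj
            rw [Pi.sub_apply, hj0, zero_sub, abs_neg]
        _ ≤ ∑ j, |(R₁.output (θ.matrix *ᵥ x) ω₁ - θ.matrix *ᵥ x) j| ^ q :=
            Finset.sum_le_sum_of_subset_of_nonneg (Finset.subset_univ _)
              fun _ _ _ => by positivity
        _ = pNorm p (R₁.output (θ.matrix *ᵥ x) ω₁ - θ.matrix *ᵥ x) ^ q := (pNorm_pow hpq _).symm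
        _ ≤ ((1 + ε / 5) * tailNorm p k (θ.matrix *ᵥ x)) ^ q :=
            pow_le_pow_left₀ (pNorm_nonneg hpq _) hC₁ q
        _ = (1 + ε / 5) ^ q * tailNorm p k (θ.matrix *ᵥ x) ^ q := mul_pow _ _ _
        _ ≤ _ := by
            -- The image of `H` has at most `k` buckets, so it competes in the tail of the sketch.
            have := tailNorm_pow_le hpq (θ.matrix *ᵥ x)
              ((Finset.card_image_le (s := H) (f := θ.1)).trans hHk)
            gcongr
    have hout := sum_uncaptured_le hpq x hHL hG.injOn (fun i => abs_sgn _) hHk hTK hε hg0 hg1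
      hG.noise_le hG.mass_le happrox
    have hslots : ∑ l, pNorm p (R₂.output (slotPart (gs θ (T θ ω₁)) l x) ω₂ -
        slotPart (gs θ (T θ ω₁)) l x) ^ q ≤ K * (2 ^ q * g ^ 2) * t := by
      calc _ ≤ ∑ _l : Fin K, 2 ^ q * (g ^ 2 * t) := by
            refine Finset.sum_le_sum fun l _ => ?_
            have htail := tailNorm_slotPart_pow_le hpq x hG.injOn (f := gs θ (T θ ω₁)) (l := l)
              (mul_nonneg (sq_nonneg g) ht0) (fun i i' hi hi' => he₂ _ _ _ hi hi') hG.bucket_le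
            refine (pow_le_pow_left₀ (pNorm_nonneg hpq _) (hC₂ l) q).trans ?_
            rw [mul_pow, one_add_one_eq_two]
            gcongr
        _ = _ := by simp; ring
    refine le_of_pow_le_pow_left₀ hpq.ne_zero
      (mul_nonneg (by linarith) (tailNorm_nonneg hpq k x)) ?_
    rw [mul_pow, hH]
    calc _ ≤ _ := herr
      _ ≤ ((1 + 4 * ((1 + ε / 5) ^ q - 1) + 3 * K * g + k * (5 + ε) * g) +
            K * (2 ^ q * g ^ 2)) * t := by
          rw [hnone, add_mul]
          exact add_le_add hout hslots
      _ ≤ _ := mul_le_mul_of_nonneg_right (error_factor_le hpq hε hg) ht0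
  set G : Set ((SignedHash n N × R₁.Ω) × R₂.Ω) := {z | pNorm p ((sketchAndRefine ν SignedHash.matrix gs R₁ R₂).output x z - x) ≤
    (1 + ε) * tailNorm p k x}
  change 1 - 1 / 3 ≤ ((ν.prod R₁.μ).prod R₂.μ).real G
  have hcover : (Set.univ : Set ((SignedHash n N × R₁.Ω) × R₂.Ω)) ⊆ (G ∪ B₁) ∪ (B₂ ∪ B₃) := by
    intro z _
    by_contra hcon
    simp only [Set.mem_union, not_or] at hcon
    exact hcon.1.1 (hgood z hcon.1.2 hcon.2.1 hcon.2.2)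
  have h1 := measureReal_mono (μ := (ν.prod R₁.μ).prod R₂.μ) hcover
  rw [probReal_univ] at h1
  have h2 := measureReal_union_le (μ := (ν.prod R₁.μ).prod R₂.μ) (G ∪ B₁) (B₂ ∪ B₃)
  have h3 := measureReal_union_le (μ := (ν.prod R₁.μ).prod R₂.μ) G B₁
  have h4 := measureReal_union_le (μ := (ν.prod R₁.μ).prod R₂.μ) B₂ B₃
  linarith

end Main

end SparseRecovery

end

/-! ### Choice of the constants -/

theorem mainTheorem4 (p : ENNReal) (hp : p = 1 ∨ p = 2) (C₀ : ℕ) :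
    ∃ (C₁ a C₂ : ℕ) (c : ℝ), 1 ≤ C₁ ∧ 0 < c ∧ c < 1 ∧
      ∀ m s : ℕ → ℝ → ℕ → ℝ → ℕ,
        SparseRecovery.HasOneRoundAlgs p m s →
        (∀ (k : ℕ) (ε : ℝ) (n : ℕ) (δ : ℝ), 1 ≤ k → k ≤ n → 0 < ε → 0 < δ → δ < 1 →
          s k ε n δ ≤ C₀ * k) →
        ∀ (k n : ℕ) (ε : ℝ), 1 ≤ k → 1 ≤ n → 0 < ε →
          ∃ m₂ : ℕ, m₂ ≤ C₂ * k * m 1 1 n (c / k) ∧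
            ∃ R : SparseRecovery.TwoRoundAlg n
                (m k (ε / 5) (C₁ * ⌈(k : ℝ) / min ε 1⌉₊ ^ a) (1 / 100)) m₂,
              R.Succeeds p k ε (1 / 3) := by
  obtain ⟨q, hpq⟩ : ∃ q, SparseRecovery.IsExponent p q := by
    rcases hp with rfl | rfl
    · exact ⟨1, Or.inl ⟨rfl, rfl⟩⟩
    · exact ⟨2, Or.inr ⟨rfl, rfl⟩⟩
  -- `D = 5(7C₀ + 6)`: with `K = C₀ k` and `g² ≤ g`, the condition on `g` becomes `k g (7C₀ + 5 + ε)
  -- ≤ ε/5`.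
  set D : ℕ := 35 * C₀ + 30 with hD
  have hc0 : (0 : ℝ) < 1 / (100 * (C₀ + 1)) := by positivity
  have hc1 : (1 : ℝ) / (100 * (C₀ + 1)) ≤ 1 / 100 := by
    apply one_div_le_one_div_of_le <;> [norm_num; nlinarith [(Nat.cast_nonneg C₀ : (0 : ℝ) ≤ C₀)]]
  -- With `U = D M`, `g = 1/U` and `τ = g⁴/400`, one has `k + 1/τ ≤ 401 U⁴`; the birthday bound
  -- squares this, so `N = 50 · 401² U⁸`. The `+ 1` in `c` covers `C₀ = 0`.
  refine ⟨50 * 401 ^ 2 * D ^ 8, 8, C₀, 1 / (100 * (C₀ + 1)), ?_, hc0, by linarith, ?_⟩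
  · have : 0 < 50 * 401 ^ 2 * D ^ 8 := by positivity
    exact this
  intro m s hms hs k n ε hk hn hε
  have hkR : (1 : ℝ) ≤ k := by exact_mod_cast hk
  have hk0 : (0 : ℝ) < k := by linarith
  set ε' : ℝ := min ε 1 with hε'
  have hε'0 : 0 < ε' := lt_min hε one_pos
  set M : ℕ := ⌈(k : ℝ) / ε'⌉₊ with hM
  have hkM' : (k : ℝ) / ε' ≤ M := Nat.le_ceil _
  have hkM : (k : ℝ) ≤ M := by
    refine le_trans ?_ hkM'
    rw [le_div_iff₀ hε'0]
    nlinarith [min_le_right ε 1]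
  have hM1 : (1 : ℝ) ≤ M := hkR.trans hkM
  have hD30 : (30 : ℝ) ≤ D := by rw [hD]; push_cast; linarith [(Nat.cast_nonneg C₀ : (0 : ℝ) ≤ C₀)]
  set N : ℕ := 50 * 401 ^ 2 * D ^ 8 * M ^ 8 with hN
  set U : ℝ := D * M with hU
  have hU1 : 1 ≤ U := by nlinarith
  have hMU : (M : ℝ) ≤ U := by nlinarith
  have hNU : (N : ℝ) = 50 * 401 ^ 2 * U ^ 8 := by rw [hN, hU]; push_cast; ring
  have hU4 : 1 ≤ U ^ 4 := one_le_pow₀ hU1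
  have hUU4 : U ≤ U ^ 4 := le_self_pow₀ hU1 (by norm_num)
  have hU48 : U ^ 4 ≤ U ^ 8 := pow_le_pow_right₀ hU1 (by norm_num)
  have hkN : k ≤ N := by
    have : (k : ℝ) ≤ N := by rw [hNU]; linarith
    exact_mod_cast this
  have hN0 : 0 < N := hk.trans hkN
  have hδ0 : 0 < 1 / (100 * ((C₀ : ℝ) + 1)) / k := div_pos hc0 hk0
  have hδ1 : 1 / (100 * ((C₀ : ℝ) + 1)) / k < 1 := by
    rw [div_lt_one hk0]; linarith
  obtain ⟨R₁, hR₁, hsupp⟩ := hms k (ε / 5) N (1 / 100) hk hkN (by linarith) (by norm_num)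
    (by norm_num)
  obtain ⟨R₂, hR₂, -⟩ := hms 1 1 n (1 / (100 * (C₀ + 1)) / k) le_rfl hn one_pos hδ0 hδ1
  have hsupp' : R₁.SupportBound (C₀ * k) := fun ω b =>
    (hsupp ω b).trans (hs k (ε / 5) N (1 / 100) hk hkN (by linarith) (by norm_num) (by norm_num))
  refine ⟨C₀ * k * m 1 1 n (1 / (100 * (C₀ + 1)) / k), le_rfl, ?_⟩
  have hU0 : 0 < U := by linarith
  refine SparseRecovery.sketchAndRefine_succeeds hpq (g := 1 / U) (τ := 1 / (400 * U ^ 4)) hε.le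
    hN0 hR₁ hsupp' hR₂ ?_ (by positivity) ?_ ?_ (by positivity) ?_ ?_
  · push_cast
    have : (C₀ : ℝ) * k * (1 / (100 * (C₀ + 1)) / k) = 1 / 100 * (C₀ / (C₀ + 1)) := by
      field_simp
    rw [this]
    have : (C₀ : ℝ) / (C₀ + 1) ≤ 1 := by rw [div_le_one (by positivity)]; linarith
    linarith
  · rw [div_le_one hU0]; exact hU1
  · have hg1 : 1 / U ≤ 1 := by rw [div_le_one hU0]; exact hU1
    have hg0 : 0 < 1 / U := by positivity
    have hkg : k * (1 / U) * D ≤ ε' := by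
      have h1 : (k : ℝ) ≤ M * ε' := by rwa [div_le_iff₀ hε'0] at hkM'
      have h2 : k * (1 / U) * D = k / M := by
        rw [hU]
        have : (D : ℝ) ≠ 0 := by linarith
        have : (M : ℝ) ≠ 0 := by linarith
        field_simp
      rw [h2, div_le_iff₀ (by linarith)]
      linarith
    have hkg0 : 0 ≤ k * (1 / U) := by positivity
    have hgsq : (1 / U) ^ 2 ≤ 1 / U := by nlinarith
    have hC : 0 ≤ (C₀ : ℝ) * k := by positivity
    have h4 : (C₀ : ℝ) * k * (1 / U) ^ 2 ≤ C₀ * k * (1 / U) := by gcongr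
    have h5 : k * (1 / U) * (7 * C₀ + 6) ≤ ε' / 5 := by
      have : (D : ℝ) = 5 * (7 * C₀ + 6) := by rw [hD]; push_cast; ring
      rw [this] at hkg
      linarith
    have h6 : k * (1 / U) * (7 * C₀ + 5 + ε) ≤ ε / 5 := by
      -- For `ε ≥ 1` the term `k ε g` grows with `ε`, but so does the allowance `ε/5`, so `g` of
      -- order `1/k` suffices.
      rcases le_total ε 1 with h | h
      · rw [hε', min_eq_left h] at h5
        exact (mul_le_mul_of_nonneg_left (by linarith) hkg0).trans h5
      · rw [hε', min_eq_right h] at h5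
        have h7 : (7 : ℝ) * C₀ + 5 + ε ≤ ε * (7 * C₀ + 6) := by
          nlinarith [(Nat.cast_nonneg C₀ : (0 : ℝ) ≤ C₀)]
        calc _ ≤ k * (1 / U) * (ε * (7 * C₀ + 6)) := by gcongr
          _ = ε * (k * (1 / U) * (7 * C₀ + 6)) := by ring
          _ ≤ ε * (1 / 5) := by gcongr
          _ = _ := by ring
    push_cast
    linarith
  · have h1 : (1 : ℝ) / N ≤ 1 / (400 * U ^ 4) := by
      refine one_div_le_one_div_of_le (by positivity) ?_
      rw [hNU]; linarith
    calc _ ≤ 1 / (400 * U ^ 4) + 1 / (400 * U ^ 4) := by gcongr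
      _ = _ := by field_simp; norm_num
  · have h1 : (k : ℝ) + 1 / (1 / (400 * U ^ 4)) ≤ 401 * U ^ 4 := by
      rw [one_div_one_div]; linarith
    calc _ ≤ (401 * U ^ 4) ^ 2 / (N : ℝ) := by gcongr
      _ ≤ _ := by rw [hNU]; apply le_of_eq; field_simp
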